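/- Let $M$ be a set. All structures below are over the fixed base $M$ and all homomorphisms are base-preserving. A quiver over $M$ is a set $\mathcal A$ with maps $\alpha,\beta:\mathcal A\to M$ (source and target); put $\mathcal A\,{}_\beta\times_\alpha\mathcal A=\{(x,y):\beta(x)=\alpha(y)\}$, a quiver with source $\alpha(x)$ and target $\beta(y)$. A braided quiver $(\mathcal A,R)$ is a quiver with a quiver isomorphism $R$ of $\mathcal A\,{}_\beta\times_\alpha\mathcal A$, written $R(x,y)=(x\rightharpoonup y,\,x\leftharpoonup y)$, satisfying $R_{12}R_{23}R_{12}=R_{23}R_{12}R_{23}$ on composable triples. It is non-degenerate if for each $x$ the maps $x\rightharpoonup\cdot:\alpha^{-1}(\beta(x))\to\alpha^{-1}(\alpha(x))$ and $\cdot\leftharpoonup x:\beta^{-1}(\alpha(x))\to\beta^{-1}(\beta(x))$ are bijective. With the quiver maps $f$ satisfying $(f\times f)R=R'(f\times f)$, non-degenerate braided quivers form a category $\mathbf{BQ}(M)$. A braided groupoid is a groupoid $\mathcal G$ over $M$ (product $\gamma\delta$ defined when $\beta(\gamma)=\alpha(\delta)$) with a quiver homomorphism $\sigma:\mathcal G\,{}_\beta\times_\alpha\mathcal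 G\to\mathcal G\,{}_\beta\times_\alpha\mathcal G$, $\sigma(\gamma,\delta)=(\gamma\rightharpoonup\delta,\gamma\leftharpoonup\delta)$, such that, whenever defined, $\iota_{\alpha(\delta)}\rightharpoonup\delta=\delta$, $\gamma_1\rightharpoonup(\gamma_2\rightharpoonup\delta)=(\gamma_1\gamma_2)\rightharpoonup\delta$, $(\gamma_1\gamma_2)\leftharpoonup\delta=(\gamma_1\leftharpoonup(\gamma_2\rightharpoonup\delta))(\gamma_2\leftharpoonup\delta)$, $\gamma\leftharpoonup\iota_{\beta(\gamma)}=\gamma$, $(\gamma\leftharpoonup\delta_1)\leftharpoonup\delta_2=\gamma\leftharpoonup(\delta_1\delta_2)$, $\gamma\rightharpoonup(\delta_1\delta_2)=(\gamma\rightharpoonup\delta_1)((\gamma\leftharpoonup\delta_1)\rightharpoonup\delta_2)$ and $(\gamma\rightharpoonup\delta)(\gamma\leftharpoonup\delta)=\gamma\delta$. With the groupoid homomorphisms commuting with the braidings they form a category $\mathbf{BG}(M)$. A post-groupoid is a bundle of groups $\pi:\mathcal G\to M$ (each fibre is a group, with product $\cdot$ and unit $\iota_m$; the fibres need not be isomorphic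 to one another) with a map $\Phi:\mathcal G\to M$ such that $\Phi(\iota_m)=m$, and a product $\gamma\rhd\delta$ defined when $\Phi(\gamma)=\pi(\delta)$, such that $\pi(\gamma\rhd\delta)=\pi(\gamma)$, each map $\gamma\rhd\cdot:\pi^{-1}(\Phi(\gamma))\to\pi^{-1}(\pi(\gamma))$ is bijective, and, whenever defined, $\Phi(\gamma_1\cdot(\gamma_1\rhd\gamma_2))=\Phi(\gamma_2)$, $\gamma_1\rhd(\gamma_2\cdot\gamma_2')=(\gamma_1\rhd\gamma_2)\cdot(\gamma_1\rhd\gamma_2')$ and $\gamma_1\rhd(\gamma_2\rhd\gamma_3)=(\gamma_1\cdot(\gamma_1\rhd\gamma_2))\rhd\gamma_3$. With the maps preserving $\pi,\Phi,\cdot,\rhd$ they form a category $\mathbf{PG}(M)$. Consider the following functors. - $\mathcal B:\mathbf{PG}(M)\to\mathbf{BG}(M)$ sends $\mathcal G$ to the Grossman–Larson groupoid with source $\pi$, target $\Phi$ and product $\gamma\star\delta=\gamma\cdot(\gamma\rhd\delta)$, with braiding $(\gamma,\delta)\mapsto(\gamma\rhd\delta,\ (\gamma\rhd\delta)^{-1}\star\gamma\star\delta)$,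 where the inverse is that of the groupoid. - $\mathcal P:\mathbf{BG}(M)\to\mathbf{PG}(M)$ sends $(\mathcal G,\sigma)$ to $(\mathcal G,\cdot,\rhd)$ with $\pi=\alpha$, $\Phi=\beta$, $\gamma\rhd\delta=\gamma\rightharpoonup\delta$ and $\gamma_1\cdot\gamma_2=\gamma_1(\gamma_1^{-1}\rightharpoonup\gamma_2)$ for $\alpha(\gamma_1)=\alpha(\gamma_2)$. - $\mathcal U:\mathbf{BG}(M)\to\mathbf{BQ}(M)$ forgets the groupoid structure and keeps the quiver and $\sigma$. - $\mathcal F:\mathbf{BQ}(M)\to\mathbf{BG}(M)$ sends $(\mathcal A,R)$ to its structure groupoid $\mathcal G_{\mathcal A}$ (the groupoid generated by the quiver $\mathcal A$ with relations $xy=(x\rightharpoonup y)(x\leftharpoonup y)$ for $\beta(x)=\alpha(y)$), equipped with the unique braiding making it a braided groupoid and $\mathcal A\to\mathcal G_{\mathcal A}$ compatible with $R$; on morphisms it is the induced map. **Theorem.** The functor $\mathcal P\circ\mathcal F:\mathbf{BQ}(M)\to\mathbf{PG}(M)$ is left adjoint to $\mathcal U\circ\mathcal B:\mathbf{PG}(M)\to\mathbf{BQ}(M)$.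 -/

import Mathlib

open CategoryTheory

universe u

namespace PostGpd

/-- A quiver over the set `M`: a set with a source map and a target map to `M`. -/
structure QuiverOver (M : Type u) where
  carrier : Type u
  src : carrier → M
  tgt : carrier → M

namespace QuiverOver

/-- Homomorphisms of quivers over `M` (identity on `M`). -/
@[ext]
structure Hom {M : Type u} (A B : QuiverOver M) where
  toFun : A.carrier → B.carrier
  src_toFun : ∀ x, B.src (toFun x) = A.src x
  tgt_toFun : ∀ x, B.tgt (toFun x) = A.tgt x

/-- The quiver of composable pairs `(a, b)`, `tgt a = src b`. -/
def tensor {M : Type u} (A B : QuiverOver M) : QuiverOver M where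
  carrier := {p : A.carrier × B.carrier // A.tgt p.1 = B.src p.2}
  src p := A.src p.1.1
  tgt p := B.tgt p.1.2

/-- The map `f × f` on composable pairs. -/
def Hom.square {M : Type u} {A B : QuiverOver M} (f : Hom A B) :
    Hom (tensor A A) (tensor B B) where
  toFun p := ⟨(f.toFun p.1.1, f.toFun p.1.2), by
    rw [f.tgt_toFun, f.src_toFun]; exact p.2⟩
  src_toFun _ := f.src_toFun _
  tgt_toFun _ := f.tgt_toFun _

/-- Composable triples. -/
def Triple {M : Type u} (A : QuiverOver M) : Type u :=
  {t : A.carrier × A.carrier × A.carrier // A.tgt t.1 = A.src t.2.1 ∧ A.tgt t.2.1 = A.src t.2.2}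

section
variable {M : Type u} {A : QuiverOver M} (R : Hom (tensor A A) (tensor A A))

/-- `x ⇀ y`, the first component of `R (x, y)`. -/
def Hom.lact (x y : A.carrier) (h : A.tgt x = A.src y) : A.carrier :=
  (R.toFun ⟨(x, y), h⟩).1.1

/-- `x ↼ y`, the second component of `R (x, y)`. -/
def Hom.ract (x y : A.carrier) (h : A.tgt x = A.src y) : A.carrier :=
  (R.toFun ⟨(x, y), h⟩).1.2

@[simp] theorem Hom.src_lact (x y : A.carrier) (h : A.tgt x = A.src y) :
    A.src (R.lact x y h) = A.src x := R.src_toFun ⟨(x, y), h⟩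

@[simp] theorem Hom.tgt_ract (x y : A.carrier) (h : A.tgt x = A.src y) :
    A.tgt (R.ract x y h) = A.tgt y := R.tgt_toFun ⟨(x, y), h⟩

@[simp] theorem Hom.tgt_lact (x y : A.carrier) (h : A.tgt x = A.src y) :
    A.tgt (R.lact x y h) = A.src (R.ract x y h) := (R.toFun ⟨(x, y), h⟩).2

theorem Hom.lact_congr {x y x' y' : A.carrier} (e : x = x') (e' : y = y') {h : A.tgt x = A.src y}
    {h' : A.tgt x' = A.src y'} : R.lact x y h = R.lact x' y' h' := by
  subst e e'; rfl

theorem Hom.ract_congr {x y x' y' : A.carrier} (e : x = x') (e' : y = y') {h : A.tgt x = A.src y}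
    {h' : A.tgt x' = A.src y'} : R.ract x y h = R.ract x' y' h' := by
  subst e e'; rfl

/-- `R × id` on composable triples. -/
def Hom.on12 (t : Triple A) : Triple A :=
  ⟨(R.lact t.1.1 t.1.2.1 t.2.1, R.ract t.1.1 t.1.2.1 t.2.1, t.1.2.2),
    R.tgt_lact _ _ _, (R.tgt_ract _ _ _).trans t.2.2⟩

/-- `id × R` on composable triples. -/
def Hom.on23 (t : Triple A) : Triple A :=
  ⟨(t.1.1, R.lact t.1.2.1 t.1.2.2 t.2.2, R.ract t.1.2.1 t.1.2.2 t.2.2),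
    t.2.1.trans (R.src_lact _ _ _).symm, R.tgt_lact _ _ _⟩

end

/-- A quiver endomorphism of the composable pairs, from its two components. -/
def Hom.ofActs {M : Type u} {A : QuiverOver M}
    (l r : ∀ x y : A.carrier, A.tgt x = A.src y → A.carrier)
    (hs : ∀ x y h, A.src (l x y h) = A.src x) (hm : ∀ x y h, A.tgt (l x y h) = A.src (r x y h))
    (ht : ∀ x y h, A.tgt (r x y h) = A.tgt y) : Hom (tensor A A) (tensor A A) where
  toFun p := ⟨(l p.1.1 p.1.2 p.2, r p.1.1 p.1.2 p.2), hm _ _ _⟩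
  src_toFun _ := hs _ _ _
  tgt_toFun _ := ht _ _ _

end QuiverOver

/-- Non-degenerate braided quivers over `M`: a quiver with a bijective, non-degenerate
quiver-theoretical solution `R` of the Yang-Baxter equation. -/
structure BraidedQuiver (M : Type u) extends QuiverOver M where
  R : QuiverOver.Hom (toQuiverOver.tensor toQuiverOver) (toQuiverOver.tensor toQuiverOver)
  bijective_R : Function.Bijective R.toFun
  yang_baxter : ∀ t : toQuiverOver.Triple,
    R.on12 (R.on23 (R.on12 t)) = R.on23 (R.on12 (R.on23 t))
  bijective_left : ∀ x : carrier, Function.Bijective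
    (fun y : {y : carrier // src y = tgt x} =>
      (⟨R.lact x y.1 y.2.symm, R.src_lact _ _ _⟩ : {z : carrier // src z = src x}))
  bijective_right : ∀ x : carrier, Function.Bijective
    (fun y : {y : carrier // tgt y = src x} =>
      (⟨R.ract y.1 x y.2, R.tgt_ract _ _ _⟩ : {z : carrier // tgt z = tgt x}))

namespace BraidedQuiver

@[ext]
structure Hom {M : Type u} (A B : BraidedQuiver M)
    extends toQuiverHom : QuiverOver.Hom A.toQuiverOver B.toQuiverOver where
  comm : ∀ p, toQuiverHom.square.toFun (A.R.toFun p) = B.R.toFun (toQuiverHom.square.toFun p)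

instance category (M : Type u) : Category (BraidedQuiver M) where
  Hom := Hom
  id A := ⟨⟨id, fun _ => rfl, fun _ => rfl⟩, fun _ => rfl⟩
  comp f g := ⟨⟨g.toFun ∘ f.toFun, fun x => (g.src_toFun _).trans (f.src_toFun x),
    fun x => (g.tgt_toFun _).trans (f.tgt_toFun x)⟩,
    fun p => (congrArg g.square.toFun (f.comm p)).trans (g.comm _)⟩

end BraidedQuiver

/-- A groupoid with set of objects `M`; `mul x y` is defined when `tgt x = src y`. -/
structure GroupoidOver (M : Type u) extends QuiverOver M where
  mul : ∀ x y : carrier, tgt x = src y → carrier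
  one : M → carrier
  inv : carrier → carrier
  src_mul : ∀ x y h, src (mul x y h) = src x
  tgt_mul : ∀ x y h, tgt (mul x y h) = tgt y
  src_one : ∀ m, src (one m) = m
  tgt_one : ∀ m, tgt (one m) = m
  src_inv : ∀ x, src (inv x) = tgt x
  tgt_inv : ∀ x, tgt (inv x) = src x
  mul_assoc : ∀ x y z (h : tgt x = src y) (h' : tgt y = src z),
    mul (mul x y h) z ((tgt_mul x y h).trans h') = mul x (mul y z h') (h.trans (src_mul y z h').symm)
  one_mul : ∀ x, mul (one (src x)) x (tgt_one _) = x
  mul_one : ∀ x, mul x (one (tgt x)) (src_one _).symm = x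
  mul_inv : ∀ x, mul x (inv x) (src_inv x).symm = one (src x)
  inv_mul : ∀ x, mul (inv x) x (tgt_inv x) = one (tgt x)

namespace GroupoidOver

/-- Homomorphisms of groupoids over `M`. -/
@[ext]
structure Hom {M : Type u} (G H : GroupoidOver M)
    extends toQuiverHom : QuiverOver.Hom G.toQuiverOver H.toQuiverOver where
  map_mul : ∀ x y (h : G.tgt x = G.src y), toFun (G.mul x y h) =
    H.mul (toFun x) (toFun y) (by rw [tgt_toFun, src_toFun]; exact h)

section
variable {M : Type u} (G : GroupoidOver M)

attribute [simp] src_mul tgt_mul src_one tgt_one src_inv tgt_inv mul_inv inv_mul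

@[simp] theorem mul_assoc' (x y z : G.carrier) (h : G.tgt x = G.src y)
    (h' : G.tgt (G.mul x y h) = G.src z) :
    G.mul (G.mul x y h) z h' = G.mul x (G.mul y z ((G.tgt_mul x y h).symm.trans h'))
      (h.trans (G.src_mul _ _ _).symm) := G.mul_assoc x y z h _

@[simp] theorem one_mul' (m : M) (x : G.carrier) (h : G.tgt (G.one m) = G.src x) :
    G.mul (G.one m) x h = x := by
  obtain rfl : m = G.src x := (G.tgt_one m).symm.trans h
  exact G.one_mul x

@[simp] theorem mul_one' (m : M) (x : G.carrier) (h : G.tgt x = G.src (G.one m)) :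
    G.mul x (G.one m) h = x := by
  obtain rfl : G.tgt x = m := h.trans (G.src_one m)
  exact G.mul_one x

@[simp] theorem inv_mul_cancel_left (x y : G.carrier) (h : G.tgt x = G.src y)
    (h' : G.tgt (G.inv x) = G.src (G.mul x y h)) : G.mul (G.inv x) (G.mul x y h) h' = y := by
  rw [← G.mul_assoc (G.inv x) x y (G.tgt_inv x) h]
  simp

@[simp] theorem mul_inv_cancel_left (x y : G.carrier) (h : G.tgt (G.inv x) = G.src y)
    (h' : G.tgt x = G.src (G.mul (G.inv x) y h)) : G.mul x (G.mul (G.inv x) y h) h' = y := by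
  rw [← G.mul_assoc x (G.inv x) y (G.src_inv x).symm h]
  simp

theorem mul_congr {x y x' y' : G.carrier} (e : x = x') (e' : y = y') {h : G.tgt x = G.src y}
    {h' : G.tgt x' = G.src y'} : G.mul x y h = G.mul x' y' h' := by
  subst e e'; rfl

theorem mul_left_cancel {x y z : G.carrier} {h : G.tgt x = G.src y} {h' : G.tgt x = G.src z}
    (e : G.mul x y h = G.mul x z h') : y = z := by
  have h1 := G.inv_mul_cancel_left x y h (by simp)
  have h2 := G.inv_mul_cancel_left x z h' (by simp)
  rw [← h1, ← h2]
  simp only [e]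

theorem mul_right_cancel {x y z : G.carrier} {h : G.tgt y = G.src x} {h' : G.tgt z = G.src x}
    (e : G.mul y x h = G.mul z x h') : y = z := by
  have h1 : G.mul (G.mul y x h) (G.inv x) (by simp) = y := by simp
  have h2 : G.mul (G.mul z x h') (G.inv x) (by simp) = z := by simp
  rw [← h1, ← h2]
  simp only [e]

theorem eq_inv_of_mul {x y : G.carrier} {m : M} {h : G.tgt x = G.src y}
    (e : G.mul x y h = G.one m) : x = G.inv y := by
  have hm : m = G.src x := by rw [← G.src_mul x y h, e, G.src_one]
  have hm' : m = G.tgt y := by rw [← G.tgt_mul x y h, e, G.tgt_one]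
  subst hm'
  apply G.mul_right_cancel (x := y) (h := h) (h' := by simp)
  simp [e]

@[simp] theorem inv_inv (x : G.carrier) : G.inv (G.inv x) = x :=
  (G.eq_inv_of_mul (G.mul_inv x)).symm

@[simp] theorem inv_one (m : M) : G.inv (G.one m) = G.one m :=
  (G.eq_inv_of_mul (x := G.one m) (y := G.one m) (m := m) (h := by simp) (by simp)).symm

@[simp] theorem inv_mul_rev (x y : G.carrier) (h : G.tgt x = G.src y) :
    G.inv (G.mul x y h) = G.mul (G.inv y) (G.inv x) (by simp [h]) :=
  (G.eq_inv_of_mul (m := G.tgt y) (h := by simp) (by simp)).symm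

theorem eq_one_of_mul_self {x : G.carrier} {h : G.tgt x = G.src x} (e : G.mul x x h = x) :
    x = G.one (G.src x) := by
  apply G.mul_left_cancel (x := x) (h := h) (h' := by simp [h])
  simp [e]

variable {G} {H : GroupoidOver M} (f : Hom G H)

theorem Hom.map_one (m : M) : f.toFun (G.one m) = H.one m := by
  have h := H.eq_one_of_mul_self (x := f.toFun (G.one m))
    (h := by simp [f.src_toFun, f.tgt_toFun]) (by rw [← f.map_mul _ _ (by simp)]; simp)
  rw [h]; simp [f.src_toFun]

theorem Hom.map_inv (x : G.carrier) : f.toFun (G.inv x) = H.inv (f.toFun x) := by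
  apply H.eq_inv_of_mul (m := G.tgt x) (h := by simp [f.src_toFun, f.tgt_toFun])
  rw [← f.map_mul _ _ (by simp)]
  simp [f.map_one]

end
end GroupoidOver

/-- Braided groupoids over `M`: a homomorphism of quivers `σ` on composable pairs making
`(G, G)` a matched pair of groupoids, with `(x ⇀ y)(x ↼ y) = xy`. -/
structure BraidedGroupoid (M : Type u) extends GroupoidOver M where
  σ : QuiverOver.Hom (toQuiverOver.tensor toQuiverOver) (toQuiverOver.tensor toQuiverOver)
  one_lact : ∀ x, σ.lact (one (src x)) x (tgt_one _) = x
  lact_lact : ∀ x y z (h : tgt x = src y) (h' : tgt y = src z),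
    σ.lact x (σ.lact y z h') (h.trans (σ.src_lact _ _ _).symm) =
      σ.lact (mul x y h) z ((tgt_mul x y h).trans h')
  mul_ract : ∀ x y z (h : tgt x = src y) (h' : tgt y = src z),
    σ.ract (mul x y h) z ((tgt_mul x y h).trans h') =
      mul (σ.ract x (σ.lact y z h') (h.trans (σ.src_lact _ _ _).symm)) (σ.ract y z h')
        ((σ.tgt_ract _ _ _).trans (σ.tgt_lact _ _ _))
  ract_one : ∀ x, σ.ract x (one (tgt x)) (src_one _).symm = x
  ract_ract : ∀ x y z (h : tgt x = src y) (h' : tgt y = src z),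
    σ.ract (σ.ract x y h) z ((σ.tgt_ract _ _ _).trans h') =
      σ.ract x (mul y z h') (h.trans (src_mul y z h').symm)
  lact_mul : ∀ x y z (h : tgt x = src y) (h' : tgt y = src z),
    σ.lact x (mul y z h') (h.trans (src_mul y z h').symm) =
      mul (σ.lact x y h) (σ.lact (σ.ract x y h) z ((σ.tgt_ract _ _ _).trans h'))
        ((σ.tgt_lact _ _ _).trans (σ.src_lact _ _ _).symm)
  lact_mul_ract : ∀ x y (h : tgt x = src y),
    mul (σ.lact x y h) (σ.ract x y h) (σ.tgt_lact _ _ _) = mul x y h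

namespace BraidedGroupoid

@[ext]
structure Hom {M : Type u} (G H : BraidedGroupoid M)
    extends toGroupoidHom : GroupoidOver.Hom G.toGroupoidOver H.toGroupoidOver where
  comm : ∀ p, toQuiverHom.square.toFun (G.σ.toFun p) = H.σ.toFun (toQuiverHom.square.toFun p)

instance category (M : Type u) : Category (BraidedGroupoid M) where
  Hom := Hom
  id A := ⟨⟨⟨id, fun _ => rfl, fun _ => rfl⟩, fun _ _ _ => rfl⟩, fun _ => rfl⟩
  comp f g := ⟨⟨⟨g.toFun ∘ f.toFun, fun x => (g.src_toFun _).trans (f.src_toFun x),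
    fun x => (g.tgt_toFun _).trans (f.tgt_toFun x)⟩,
    fun x y h => (congrArg g.toFun (f.map_mul x y h)).trans (g.map_mul _ _ _)⟩,
    fun p => (congrArg g.square.toFun (f.comm p)).trans (g.comm _)⟩

section
variable {M : Type u} (G : BraidedGroupoid M)

@[simp] theorem one_lact' (m : M) (x : G.carrier) (h : G.tgt (G.one m) = G.src x) :
    G.σ.lact (G.one m) x h = x := by
  obtain rfl : m = G.src x := (G.tgt_one m).symm.trans h
  exact G.one_lact x

@[simp] theorem ract_one' (m : M) (x : G.carrier) (h : G.tgt x = G.src (G.one m)) :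
    G.σ.ract x (G.one m) h = x := by
  obtain rfl : G.tgt x = m := h.trans (G.src_one m)
  exact G.ract_one x

theorem one_ract (m : M) (x : G.carrier) (h : G.tgt (G.one m) = G.src x) :
    G.σ.ract (G.one m) x h = G.one (G.tgt x) := by
  apply G.mul_left_cancel (x := G.σ.lact (G.one m) x h) (h := G.σ.tgt_lact _ _ _) (h' := by simp)
  rw [G.lact_mul_ract]; simp

theorem lact_one (m : M) (x : G.carrier) (h : G.tgt x = G.src (G.one m)) :
    G.σ.lact x (G.one m) h = G.one (G.src x) := by
  apply G.mul_right_cancel (x := G.σ.ract x (G.one m) h) (h := G.σ.tgt_lact _ _ _) (h' := by simp)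
  rw [G.lact_mul_ract]; simp

@[simp] theorem inv_lact_lact (x y : G.carrier) (h : G.tgt x = G.src y)
    (h' : G.tgt (G.inv x) = G.src (G.σ.lact x y h)) :
    G.σ.lact (G.inv x) (G.σ.lact x y h) h' = y := by
  rw [G.lact_lact _ _ _ (by simp) h]; simp

@[simp] theorem lact_inv_lact (x y : G.carrier) (h : G.tgt (G.inv x) = G.src y)
    (h' : G.tgt x = G.src (G.σ.lact (G.inv x) y h)) :
    G.σ.lact x (G.σ.lact (G.inv x) y h) h' = y := by
  rw [G.lact_lact _ _ _ (by simp) h]; simp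

@[simp] theorem ract_ract_inv (x y : G.carrier) (h : G.tgt x = G.src y)
    (h' : G.tgt (G.σ.ract x y h) = G.src (G.inv y)) :
    G.σ.ract (G.σ.ract x y h) (G.inv y) h' = x := by
  rw [G.ract_ract _ _ _ h (by simp)]; simp

@[simp] theorem ract_inv_ract (x y : G.carrier) (h : G.tgt x = G.src (G.inv y))
    (h' : G.tgt (G.σ.ract x (G.inv y) h) = G.src y) :
    G.σ.ract (G.σ.ract x (G.inv y) h) y h' = x := by
  rw [G.ract_ract _ _ _ h (by simp)]; simp

theorem inv_ract_lact (x y : G.carrier) (h : G.tgt x = G.src y) :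
    G.σ.ract (G.inv x) (G.σ.lact x y h) (by simp) = G.inv (G.σ.ract x y h) := by
  apply G.eq_inv_of_mul (m := G.tgt y) (h := by simp)
  rw [← G.mul_ract _ _ _ (by simp) h]
  simp [one_ract]

theorem ract_inv_inv (x y : G.carrier) (h : G.tgt x = G.src y) :
    G.σ.ract (G.inv (G.σ.ract x y h)) (G.inv (G.σ.lact x y h)) (by simp) = G.inv x := by
  simp only [← inv_ract_lact]
  simp

theorem lact_inv_inv (x y : G.carrier) (h : G.tgt x = G.src y) :
    G.σ.lact (G.inv (G.σ.ract x y h)) (G.inv (G.σ.lact x y h)) (by simp) = G.inv y := by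
  have e := G.lact_mul_ract (G.inv (G.σ.ract x y h)) (G.inv (G.σ.lact x y h)) (by simp)
  apply G.mul_right_cancel (h' := by simp [h, ract_inv_inv]) (h := by simp)
    (e.trans _)
  simp only [ract_inv_inv]
  rw [← G.inv_mul_rev x y h, ← G.lact_mul_ract x y h, G.inv_mul_rev]

/-- The braiding of a braided groupoid is a non-degenerate solution of the Yang-Baxter
equation on the underlying quiver. -/
def toBraidedQuiver : BraidedQuiver M where
  toQuiverOver := G.toQuiverOver
  R := G.σ
  bijective_R := by
    let τ : (G.toQuiverOver.tensor G.toQuiverOver).carrier →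
        (G.toQuiverOver.tensor G.toQuiverOver).carrier :=
      fun p => ⟨(G.inv p.1.2, G.inv p.1.1), by simp [p.2]⟩
    have hτ : ∀ p, τ (τ p) = p := fun p => Subtype.ext (by simp [τ])
    have hσ : ∀ p, G.σ.toFun (τ (G.σ.toFun p)) = τ p := fun p =>
      Subtype.ext (Prod.ext (G.lact_inv_inv p.1.1 p.1.2 p.2) (G.ract_inv_inv p.1.1 p.1.2 p.2))
    refine Function.bijective_iff_has_inverse.2 ⟨fun p => τ (G.σ.toFun (τ p)), fun p => ?_,
      fun p => ?_⟩
    · simp only [hσ, hτ]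
    · have := hσ (τ p)
      rwa [hτ] at this
  yang_baxter := by
    rintro ⟨⟨x, y, z⟩, h, h'⟩
    have e1 : (G.σ.on12 (G.σ.on23 (G.σ.on12 ⟨⟨x, y, z⟩, h, h'⟩))).1.1 =
        (G.σ.on23 (G.σ.on12 (G.σ.on23 ⟨⟨x, y, z⟩, h, h'⟩))).1.1 := by
      simp only [QuiverOver.Hom.on12, QuiverOver.Hom.on23]
      dsimp only at h h'
      rw [G.lact_lact x y z h h', G.lact_lact _ _ z (G.σ.tgt_lact _ _ _) (by simp [h'])]
      simp only [G.lact_mul_ract]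
    have e3 : (G.σ.on12 (G.σ.on23 (G.σ.on12 ⟨⟨x, y, z⟩, h, h'⟩))).1.2.2 =
        (G.σ.on23 (G.σ.on12 (G.σ.on23 ⟨⟨x, y, z⟩, h, h'⟩))).1.2.2 := by
      simp only [QuiverOver.Hom.on12, QuiverOver.Hom.on23]
      dsimp only at h h'
      rw [G.ract_ract x y z h h', G.ract_ract x _ _ (by simp [h]) (G.σ.tgt_lact _ _ _)]
      simp only [G.lact_mul_ract]
    let P : G.toQuiverOver.Triple → G.carrier := fun t =>
      G.mul t.1.1 (G.mul t.1.2.1 t.1.2.2 t.2.2) (by rw [G.src_mul]; exact t.2.1)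
    have h12 : ∀ t, P (G.σ.on12 t) = P t := fun t => by
      have e := G.lact_mul_ract t.1.1 t.1.2.1 t.2.1
      simp only [P, QuiverOver.Hom.on12]
      rw [← G.mul_assoc _ _ _ (G.σ.tgt_lact _ _ _), ← G.mul_assoc _ _ _ t.2.1]
      simp only [e]
    have h23 : ∀ t, P (G.σ.on23 t) = P t := fun t => by
      have e := G.lact_mul_ract t.1.2.1 t.1.2.2 t.2.2
      simp only [P, QuiverOver.Hom.on23, e]
    have eP : P (G.σ.on12 (G.σ.on23 (G.σ.on12 ⟨⟨x, y, z⟩, h, h'⟩))) =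
        P (G.σ.on23 (G.σ.on12 (G.σ.on23 ⟨⟨x, y, z⟩, h, h'⟩))) := by
      rw [h12, h23]
      exact (h12 _).trans ((h23 _).trans ((h12 _).trans (h23 _))).symm
    revert e1 e3 eP
    generalize G.σ.on12 (G.σ.on23 (G.σ.on12 ⟨⟨x, y, z⟩, h, h'⟩)) = s
    generalize G.σ.on23 (G.σ.on12 (G.σ.on23 ⟨⟨x, y, z⟩, h, h'⟩)) = t
    obtain ⟨⟨s1, s2, s3⟩, hs⟩ := s
    obtain ⟨⟨t1, t2, t3⟩, ht⟩ := t
    intro e1 e3 eP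
    dsimp only at e1 e3
    subst e1 e3
    obtain rfl : s2 = t2 := G.mul_right_cancel (G.mul_left_cancel eP)
    rfl
  bijective_left x := Function.bijective_iff_has_inverse.2
    ⟨fun y => ⟨G.σ.lact (G.inv x) y.1 (by simp [y.2]), by simp⟩,
      fun y => Subtype.ext (by simp), fun y => Subtype.ext (by simp)⟩
  bijective_right x := Function.bijective_iff_has_inverse.2
    ⟨fun y => ⟨G.σ.ract y.1 (G.inv x) (by simp [y.2]), by simp⟩,
      fun y => Subtype.ext (by simp), fun y => Subtype.ext (by simp)⟩

end

section
variable {M : Type u} {G H : BraidedGroupoid M}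

theorem Hom.map_lact (f : Hom G H) (x y : G.carrier) (h : G.tgt x = G.src y) :
    f.toFun (G.σ.lact x y h) = H.σ.lact (f.toFun x) (f.toFun y)
      (by rw [f.tgt_toFun, f.src_toFun]; exact h) :=
  congrArg (fun p => p.1.1) (f.comm ⟨(x, y), h⟩)

theorem Hom.map_ract (f : Hom G H) (x y : G.carrier) (h : G.tgt x = G.src y) :
    f.toFun (G.σ.ract x y h) = H.σ.ract (f.toFun x) (f.toFun y)
      (by rw [f.tgt_toFun, f.src_toFun]; exact h) :=
  congrArg (fun p => p.1.2) (f.comm ⟨(x, y), h⟩)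

/-- A groupoid homomorphism compatible with the left actions is a homomorphism of braided
groupoids. -/
def Hom.ofLact (f : GroupoidOver.Hom G.toGroupoidOver H.toGroupoidOver)
    (hf : ∀ x y (h : G.tgt x = G.src y), f.toFun (G.σ.lact x y h) =
      H.σ.lact (f.toFun x) (f.toFun y) (by rw [f.tgt_toFun, f.src_toFun]; exact h)) :
    Hom G H where
  toGroupoidHom := f
  comm := by
    rintro ⟨⟨x, y⟩, h⟩
    have h0 : H.tgt (f.toFun x) = H.src (f.toFun y) := by
      rw [f.tgt_toFun, f.src_toFun]; exact h
    refine Subtype.ext (Prod.ext (hf x y h) ?_)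
    change f.toFun (G.σ.ract x y h) = H.σ.ract (f.toFun x) (f.toFun y) h0
    have e := congrArg f.toFun (G.lact_mul_ract x y h)
    rw [f.map_mul, f.map_mul] at e
    simp only [hf] at e
    exact H.mul_left_cancel (e.trans (H.lact_mul_ract _ _ h0).symm)

end

/-- A braided groupoid from a left action `⇀` of a groupoid on itself: `x ↼ y` is
`(x ⇀ y)⁻¹ x y`. -/
def ofLact {M : Type u} (G : GroupoidOver M)
    (l : ∀ x y : G.carrier, G.tgt x = G.src y → G.carrier)
    (src_l : ∀ x y h, G.src (l x y h) = G.src x)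
    (one_l : ∀ m x h, l (G.one m) x h = x)
    (l_one : ∀ m x h, l x (G.one m) h = G.one (G.src x))
    (l_l : ∀ x y z h h', l x (l y z h') (h.trans (src_l _ _ _).symm) =
      l (G.mul x y h) z ((G.tgt_mul x y h).trans h'))
    (l_mul : ∀ x y z h h', l x (G.mul y z h') (h.trans (G.src_mul y z h').symm) =
      G.mul (l x y h) (l (G.mul (G.inv (l x y h)) (G.mul x y h) (by simp [src_l])) z
        (by simp [h'])) (by simp [src_l])) : BraidedGroupoid M where
  toGroupoidOver := G
  σ := QuiverOver.Hom.ofActs l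
    (fun x y h => G.mul (G.inv (l x y h)) (G.mul x y h) (by simp [src_l]))
    src_l (by simp) (by simp)
  one_lact x := one_l _ _ _
  lact_lact := l_l
  mul_ract x y z h h' := by
    simp only [QuiverOver.Hom.lact, QuiverOver.Hom.ract, QuiverOver.Hom.ofActs]
    rw [G.mul_assoc' (G.inv (l x (l y z h') (h.trans (src_l _ _ _).symm)))]
    simp [l_l x y z h h']
  ract_one x := by
    simp only [QuiverOver.Hom.ract, QuiverOver.Hom.ofActs]
    simp [l_one]
  ract_ract x y z h h' := by
    simp only [QuiverOver.Hom.ract, QuiverOver.Hom.ofActs]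
    simp [l_mul x y z h h']
  lact_mul x y z h h' := l_mul x y z h h'
  lact_mul_ract x y h := by
    simp only [QuiverOver.Hom.lact, QuiverOver.Hom.ract, QuiverOver.Hom.ofActs]
    simp

@[simp] theorem ofLact_lact {M : Type u} (G : GroupoidOver M) (l src_l one_l l_one l_l l_mul)
    (x y : G.carrier) (h : G.tgt x = G.src y) :
    (ofLact G l src_l one_l l_one l_l l_mul).σ.lact x y h = l x y h := rfl

end BraidedGroupoid

/-- A bundle of groups over `M`: the fibres of `proj` are groups; `mul x y` is defined when
`proj x = proj y`. -/
structure GroupBundle (M : Type u) where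
  carrier : Type u
  proj : carrier → M
  mul : ∀ x y : carrier, proj x = proj y → carrier
  one : M → carrier
  inv : carrier → carrier
  proj_mul : ∀ x y h, proj (mul x y h) = proj x
  proj_one : ∀ m, proj (one m) = m
  proj_inv : ∀ x, proj (inv x) = proj x
  mul_assoc : ∀ x y z (h : proj x = proj y) (h' : proj y = proj z),
    mul (mul x y h) z ((proj_mul x y h).trans (h.trans h')) =
      mul x (mul y z h') (h.trans (proj_mul y z h').symm)
  one_mul : ∀ x, mul (one (proj x)) x (proj_one _) = x
  mul_one : ∀ x, mul x (one (proj x)) (proj_one _).symm = x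
  mul_inv : ∀ x, mul x (inv x) (proj_inv x).symm = one (proj x)
  inv_mul : ∀ x, mul (inv x) x (proj_inv x) = one (proj x)

/-- A bundle of groups is a groupoid whose source and target maps agree. -/
abbrev GroupBundle.groupoid {M : Type u} (G : GroupBundle M) : GroupoidOver M where
  carrier := G.carrier
  src := G.proj
  tgt := G.proj
  mul := G.mul
  one := G.one
  inv := G.inv
  src_mul := G.proj_mul
  tgt_mul x y h := (G.proj_mul x y h).trans h
  src_one := G.proj_one
  tgt_one := G.proj_one
  src_inv := G.proj_inv
  tgt_inv := G.proj_inv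
  mul_assoc := G.mul_assoc
  one_mul := G.one_mul
  mul_one := G.mul_one
  mul_inv := G.mul_inv
  inv_mul := G.inv_mul

/-- Post-groupoids over `M`. The product `act x y = x ▷ y` is defined when `Φ x = proj y`.
Surjectivity of `Φ` follows from `Φ_one`. -/
structure PostGroupoid (M : Type u) extends GroupBundle M where
  Φ : carrier → M
  Φ_one : ∀ m, Φ (one m) = m
  act : ∀ x y : carrier, Φ x = proj y → carrier
  proj_act : ∀ x y h, proj (act x y h) = proj x
  bijective_act : ∀ x : carrier, Function.Bijective
    (fun y : {y : carrier // proj y = Φ x} =>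
      (⟨act x y.1 y.2.symm, proj_act _ _ _⟩ : {z : carrier // proj z = proj x}))
  Φ_mul_act : ∀ x y (h : Φ x = proj y), Φ (mul x (act x y h) (proj_act _ _ _).symm) = Φ y
  act_mul : ∀ x y z (h : Φ x = proj y) (h' : proj y = proj z),
    act x (mul y z h') (h.trans (proj_mul _ _ _).symm) =
      mul (act x y h) (act x z (h.trans h')) ((proj_act _ _ _).trans (proj_act _ _ _).symm)
  act_act : ∀ x y z (h : Φ x = proj y) (h' : Φ y = proj z),
    act x (act y z h') (h.trans (proj_act _ _ _).symm) =
      act (mul x (act x y h) (proj_act _ _ _).symm) z ((Φ_mul_act x y h).trans h')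

namespace PostGroupoid

@[ext]
structure Hom {M : Type u} (G H : PostGroupoid M) where
  toFun : G.carrier → H.carrier
  proj_toFun : ∀ x, H.proj (toFun x) = G.proj x
  Φ_toFun : ∀ x, H.Φ (toFun x) = G.Φ x
  map_mul : ∀ x y (h : G.proj x = G.proj y), toFun (G.mul x y h) =
    H.mul (toFun x) (toFun y) (by rw [proj_toFun, proj_toFun]; exact h)
  map_act : ∀ x y (h : G.Φ x = G.proj y), toFun (G.act x y h) =
    H.act (toFun x) (toFun y) (by rw [Φ_toFun, proj_toFun]; exact h)

instance category (M : Type u) : Category (PostGroupoid M) where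
  Hom := Hom
  id A := ⟨id, fun _ => rfl, fun _ => rfl, fun _ _ _ => rfl, fun _ _ _ => rfl⟩
  comp f g := ⟨g.toFun ∘ f.toFun, fun x => (g.proj_toFun _).trans (f.proj_toFun x),
    fun x => (g.Φ_toFun _).trans (f.Φ_toFun x),
    fun x y h => (congrArg g.toFun (f.map_mul x y h)).trans (g.map_mul _ _ _),
    fun x y h => (congrArg g.toFun (f.map_act x y h)).trans (g.map_act _ _ _)⟩

section
variable {M : Type u} (G : PostGroupoid M)

attribute [simp] GroupBundle.proj_mul GroupBundle.proj_one GroupBundle.proj_inv proj_act Φ_one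
  Φ_mul_act

theorem act_injective {x y z : G.carrier} {h : G.Φ x = G.proj y} {h' : G.Φ x = G.proj z}
    (e : G.act x y h = G.act x z h') : y = z :=
  congrArg Subtype.val (@(G.bijective_act x).1 ⟨y, h.symm⟩ ⟨z, h'.symm⟩ (Subtype.ext e))

theorem act_one (m : M) (x : G.carrier) (h : G.Φ x = G.proj (G.one m)) :
    G.act x (G.one m) h = G.one (G.proj x) := by
  have e := G.act_mul x (G.one m) (G.one m) h rfl
  have e1 : G.mul (G.one m) (G.one m) rfl = G.one m := G.groupoid.one_mul' m (G.one m) rfl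
  simp only [e1] at e
  have := G.groupoid.eq_one_of_mul_self e.symm
  simpa using this

theorem one_act (m : M) (x : G.carrier) (h : G.Φ (G.one m) = G.proj x) :
    G.act (G.one m) x h = x := by
  have hm : m = G.proj x := (G.Φ_one m).symm.trans h
  have e := G.act_act (G.one m) (G.one m) x (by simp) h
  simp only [act_one] at e
  have e1 : G.mul (G.one m) (G.one (G.proj (G.one m))) (by simp) = G.one m :=
    G.groupoid.mul_one' _ (G.one m) _
  simp only [e1] at e
  exact G.act_injective e

theorem act_congr {x y x' y' : G.carrier} (e : x = x') (e' : y = y') {h : G.Φ x = G.proj y}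
    {h' : G.Φ x' = G.proj y'} : G.act x y h = G.act x' y' h' := by
  subst e e'; rfl

/-- The inverse of the left multiplication `x ▷ ·`. -/
noncomputable def actInv (x z : G.carrier) (h : G.proj z = G.proj x) : G.carrier :=
  ((Equiv.ofBijective _ (G.bijective_act x)).symm ⟨z, h⟩).1

@[simp] theorem proj_actInv (x z : G.carrier) (h : G.proj z = G.proj x) :
    G.proj (G.actInv x z h) = G.Φ x :=
  ((Equiv.ofBijective _ (G.bijective_act x)).symm ⟨z, h⟩).2

@[simp] theorem act_actInv (x z : G.carrier) (h : G.proj z = G.proj x)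
    (h' : G.Φ x = G.proj (G.actInv x z h)) : G.act x (G.actInv x z h) h' = z :=
  congrArg Subtype.val ((Equiv.ofBijective _ (G.bijective_act x)).apply_symm_apply ⟨z, h⟩)

/-- The Grossman-Larson groupoid: `x ⋆ y = x · (x ▷ y)`. -/
noncomputable def grossmanLarson : GroupoidOver M where
  carrier := G.carrier
  src := G.proj
  tgt := G.Φ
  mul x y h := G.mul x (G.act x y h) (by simp)
  one := G.one
  inv x := G.actInv x (G.inv x) (by simp)
  src_mul := by simp
  tgt_mul := by simp
  src_one := by simp
  tgt_one := by simp
  src_inv := by simp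
  tgt_inv x := by
    have := G.Φ_mul_act x (G.actInv x (G.inv x) (by simp)) (by simp)
    rw [← this]
    simp [G.mul_inv]
  mul_assoc x y z h h' := by
    simp only [← G.act_act x y z h h', G.act_mul x y _ h (G.proj_act y z h').symm]
    exact G.mul_assoc _ _ _ _ _
  one_mul x := by
    simp only [one_act]
    exact G.one_mul x
  mul_one x := by
    simp only [act_one]
    exact G.mul_one x
  mul_inv x := by simp [G.mul_inv]
  inv_mul x := by
    have ht : G.Φ (G.actInv x (G.inv x) (by simp)) = G.proj x := by
      have := G.Φ_mul_act x (G.actInv x (G.inv x) (by simp)) (by simp)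
      rw [← this]
      simp [G.mul_inv]
    apply G.act_injective (x := x) (h := by simp) (h' := by simp)
    rw [G.act_mul _ _ _ (by simp) (by simp)]
    simp only [act_actInv, act_one]
    simp only [G.act_act x _ x (by simp) ht, act_actInv, G.mul_inv, one_act]
    exact G.inv_mul x

/-- The Grossman-Larson groupoid with the braiding
`(x, y) ↦ (x ▷ y, (x ▷ y)⁻¹ ⋆ x ⋆ y)`. -/
noncomputable def toBraidedGroupoid : BraidedGroupoid M :=
  BraidedGroupoid.ofLact G.grossmanLarson G.act G.proj_act
    (fun m x h => G.one_act m x h) (fun m x h => G.act_one m x h) G.act_act (by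
      intro x y z h h'
      let S := G.grossmanLarson
      have hw : S.tgt (S.mul (S.inv (G.act x y h)) (S.mul x y h)
          ((S.tgt_inv _).trans ((G.proj_act x y h).trans (S.src_mul x y h).symm))) = G.proj z := by
        rw [S.tgt_mul, S.tgt_mul]; exact h'
      refine (G.act_mul x y (G.act y z h') h (G.proj_act y z h').symm).trans
        (G.groupoid.mul_congr rfl ((G.act_act x y z h h').trans ?_))
      refine Eq.trans ?_ (G.act_act (G.act x y h) _ z
        ((S.src_inv _).symm.trans (S.src_mul _ _ _).symm) hw).symm
      exact G.act_congr (S.mul_inv_cancel_left (G.act x y h) (S.mul x y h) _ _).symm rfl)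

/-- A homomorphism of post-groupoids is a homomorphism of the associated braided groupoids. -/
noncomputable def mapBraidedGroupoid {G H : PostGroupoid M} (f : Hom G H) :
    BraidedGroupoid.Hom G.toBraidedGroupoid H.toBraidedGroupoid :=
  BraidedGroupoid.Hom.ofLact
    { toFun := f.toFun
      src_toFun := f.proj_toFun
      tgt_toFun := f.Φ_toFun
      map_mul := fun x y h => (f.map_mul _ _ _).trans
        (H.groupoid.mul_congr rfl (f.map_act x y h)) }
    f.map_act

end
end PostGroupoid

namespace BraidedGroupoid
section
variable {M : Type u} (G : BraidedGroupoid M)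

/-- The product `x · y = x ⋆ (x⁻¹ ⇀ y)` on the fibres of the source map. -/
def dot (x y : G.carrier) (h : G.src x = G.src y) : G.carrier :=
  G.mul x (G.σ.lact (G.inv x) y ((G.tgt_inv x).trans h)) (by simp)

theorem src_dot (x y : G.carrier) (h : G.src x = G.src y) : G.src (G.dot x y h) = G.src x :=
  G.src_mul _ _ _

theorem dot_lact (x y : G.carrier) (h : G.tgt x = G.src y) :
    G.dot x (G.σ.lact x y h) (by simp) = G.mul x y h := by
  simp [dot]

theorem lact_dot (x y z : G.carrier) (h : G.tgt x = G.src y) (h' : G.src y = G.src z) :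
    G.σ.lact x (G.dot y z h') (by rw [src_dot]; exact h) =
      G.dot (G.σ.lact x y h) (G.σ.lact x z (h.trans h')) (by simp) := by
  have h1 : G.tgt (G.inv y) = G.src z := (G.tgt_inv y).trans h'
  refine (G.lact_mul x y (G.σ.lact (G.inv y) z h1) h (by simp)).trans (G.mul_congr rfl ?_)
  have e : G.σ.lact (G.σ.lact x y h) (G.σ.lact (G.σ.ract x y h) (G.σ.lact (G.inv y) z h1)
      (by simp)) (by simp) = G.σ.lact x z (h.trans h') := by
    rw [G.lact_lact _ _ _ (G.σ.tgt_lact _ _ _) (by simp)]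
    simp only [G.lact_mul_ract]
    rw [← G.lact_lact _ _ _ h (by simp)]
    simp
  simp only [← e, inv_lact_lact]

theorem dot_assoc (x y z : G.carrier) (h : G.src x = G.src y) (h' : G.src y = G.src z) :
    G.dot (G.dot x y h) z ((G.src_dot x y h).trans (h.trans h')) =
      G.dot x (G.dot y z h') (h.trans (G.src_dot y z h').symm) := by
  have e := G.lact_dot (G.inv x) y z ((G.tgt_inv x).trans h) h'
  conv_rhs => rw [dot]
  simp only [e]
  simp only [dot]
  rw [G.mul_assoc']
  refine G.mul_congr rfl (G.mul_congr rfl ?_)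
  rw [G.lact_lact _ _ _ (by simp) (by simp [h, h'])]
  exact G.σ.lact_congr (by simp) rfl

theorem one_dot (x : G.carrier) : G.dot (G.one (G.src x)) x (G.src_one _) = x := by
  simp [dot]

theorem dot_one (x : G.carrier) : G.dot x (G.one (G.src x)) (G.src_one _).symm = x := by
  simp [dot, lact_one]

theorem dot_lact_inv (x : G.carrier) :
    G.dot x (G.σ.lact x (G.inv x) (by simp)) (by simp) = G.one (G.src x) := by
  rw [dot_lact]; simp

theorem lact_inv_dot (x : G.carrier) :
    G.dot (G.σ.lact x (G.inv x) (by simp)) x (by simp) = G.one (G.src x) := by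
  have key : ∀ u v (h : G.src x = G.src u) (h' : G.src u = G.src v),
      G.dot x u h = G.one (G.src x) → G.dot u v h' = G.one (G.src u) → x = v := by
    intro u v h h' e e'
    have a := G.dot_assoc x u v h h'
    simp only [e, e', ← h] at a
    rw [G.dot_one] at a
    rw [← a]
    simp [h, h', dot]
  have e := key (G.σ.lact x (G.inv x) (by simp)) _ (by simp) (by simp) (G.dot_lact_inv x)
    (G.dot_lact_inv _)
  have e' := G.dot_lact_inv (G.σ.lact x (G.inv x) (by simp))
  simp only [← e] at e'
  simpa using e'

/-- The post-groupoid of a braided groupoid: `x ▷ y = x ⇀ y` and `x · y = x ⋆ (x⁻¹ ⇀ y)`. -/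
def toPostGroupoid : PostGroupoid M where
  carrier := G.carrier
  proj := G.src
  mul := G.dot
  one := G.one
  inv x := G.σ.lact x (G.inv x) (by simp)
  proj_mul := G.src_dot
  proj_one := G.src_one
  proj_inv x := by simp
  mul_assoc := G.dot_assoc
  one_mul := G.one_dot
  mul_one := G.dot_one
  mul_inv := G.dot_lact_inv
  inv_mul := G.lact_inv_dot
  Φ := G.tgt
  Φ_one := G.tgt_one
  act := G.σ.lact
  proj_act := G.σ.src_lact
  bijective_act := G.toBraidedQuiver.bijective_left
  Φ_mul_act _ _ _ := by
    simp only [G.dot_lact, G.tgt_mul]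
  act_mul := G.lact_dot
  act_act x y z h h' := (G.lact_lact x y z h h').trans
    (G.σ.lact_congr (G.dot_lact x y h).symm rfl)

variable {G}

/-- A homomorphism of braided groupoids is a homomorphism of the associated post-groupoids. -/
def mapPostGroupoid {H : BraidedGroupoid M} (f : Hom G H) :
    PostGroupoid.Hom G.toPostGroupoid H.toPostGroupoid where
  toFun := f.toFun
  proj_toFun := f.src_toFun
  Φ_toFun := f.tgt_toFun
  map_mul x _ _ := (f.map_mul _ _ _).trans (H.mul_congr rfl ((f.map_lact _ _ _).trans
    (H.σ.lact_congr (f.map_inv x) rfl)))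
  map_act := f.map_lact

end
end BraidedGroupoid

/-- The forgetful functor from braided groupoids to non-degenerate braided quivers. -/
def functorU (M : Type u) : BraidedGroupoid M ⥤ BraidedQuiver M where
  obj G := G.toBraidedQuiver
  map f := ⟨f.toQuiverHom, f.comm⟩

/-- The functor from post-groupoids to braided groupoids. -/
noncomputable def functorB (M : Type u) : PostGroupoid M ⥤ BraidedGroupoid M where
  obj G := G.toBraidedGroupoid
  map f := PostGroupoid.mapBraidedGroupoid f

/-- The functor from braided groupoids to post-groupoids. -/
def functorP (M : Type u) : BraidedGroupoid M ⥤ PostGroupoid M where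
  obj G := G.toPostGroupoid
  map f := BraidedGroupoid.mapPostGroupoid f

/-- A right action of a groupoid on `p : E → M`. -/
structure RightAction {M : Type u} (G : GroupoidOver M) {E : Type u} (p : E → M) where
  act : ∀ (e : E) (g : G.carrier), p e = G.src g → E
  p_act : ∀ e g h, p (act e g h) = G.tgt g
  act_one : ∀ e m h, act e (G.one m) h = e
  act_mul : ∀ e g g' h h', act e (G.mul g g' h') (h.trans (G.src_mul _ _ _).symm) =
    act (act e g h) g' ((p_act e g h).trans h')

namespace RightAction
variable {M : Type u} {G : GroupoidOver M} {E : Type u} {p : E → M} (a : RightAction G p)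

theorem act_congr {e e' : E} {g g' : G.carrier} (he : e = e') (hg : g = g') {h : p e = G.src g}
    {h' : p e' = G.src g'} : a.act e g h = a.act e' g' h' := by
  subst he hg; rfl

@[simp] theorem act_act_inv (e : E) (g : G.carrier) (h : p e = G.src g)
    (h' : p (a.act e g h) = G.src (G.inv g)) : a.act (a.act e g h) (G.inv g) h' = e := by
  rw [← a.act_mul e g (G.inv g) h (by simp)]
  exact (a.act_congr rfl (G.mul_inv g) (h' := by simp [h])).trans (a.act_one _ _ _)

@[simp] theorem act_inv_act (e : E) (g : G.carrier) (h : p e = G.src (G.inv g))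
    (h' : p (a.act e (G.inv g) h) = G.src g) : a.act (a.act e (G.inv g) h) g h' = e := by
  rw [← a.act_mul e (G.inv g) g h (by simp)]
  exact (a.act_congr rfl (G.inv_mul g) (h' := by simpa using h)).trans (a.act_one _ _ _)

end RightAction

/-- The groupoid of bijections between the fibres of `p : E → M`. -/
def fibreGroupoid {M : Type u} {E : Type u} (p : E → M) : GroupoidOver M where
  carrier := Σ m : M, Σ n : M, ({e : E // p e = m} ≃ {e : E // p e = n})
  src x := x.1
  tgt x := x.2.1
  mul x y h := ⟨x.1, y.2.1, (x.2.2.trans (Equiv.subtypeEquivRight (by simp [h]))).trans y.2.2⟩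
  one m := ⟨m, m, Equiv.refl _⟩
  inv x := ⟨x.2.1, x.1, x.2.2.symm⟩
  src_mul _ _ _ := rfl
  tgt_mul _ _ _ := rfl
  src_one _ := rfl
  tgt_one _ := rfl
  src_inv _ := rfl
  tgt_inv _ := rfl
  mul_assoc := by
    rintro ⟨m, n, x⟩ ⟨n', k, y⟩ ⟨k', l, z⟩ h h'
    rfl
  one_mul := by rintro ⟨m, n, x⟩; rfl
  mul_one := by rintro ⟨m, n, x⟩; rfl
  mul_inv := by
    rintro ⟨m, n, x⟩
    exact congrArg (fun e => (⟨m, m, e⟩ : Σ m : M, Σ n : M,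
      ({e : E // p e = m} ≃ {e : E // p e = n}))) (Equiv.self_trans_symm x)
  inv_mul := by
    rintro ⟨m, n, x⟩
    exact congrArg (fun e => (⟨n, n, e⟩ : Σ m : M, Σ n : M,
      ({e : E // p e = m} ≃ {e : E // p e = n}))) (Equiv.symm_trans_self x)

theorem fibreGroupoid_ext {M : Type u} {E : Type u} {p : E → M}
    {x y : (fibreGroupoid p).carrier} (h : x.1 = y.1) (h' : x.2.1 = y.2.1)
    (e : ∀ e h h', (x.2.2 ⟨e, h⟩).1 = (y.2.2 ⟨e, h'⟩).1) : x = y := by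
  obtain ⟨m, n, x⟩ := x
  obtain ⟨m', n', y⟩ := y
  dsimp only at h h'
  subst h h'
  obtain rfl : x = y := Equiv.ext fun ⟨a, ha⟩ => Subtype.ext (e a ha ha)
  rfl

/-- A homomorphism to the groupoid of bijections between the fibres is a right action. -/
def RightAction.ofHom {M : Type u} {G : GroupoidOver M} {E : Type u} {p : E → M}
    (f : GroupoidOver.Hom G (fibreGroupoid p)) : RightAction G p where
  act e g h := ((f.toFun g).2.2 ⟨e, h.trans (f.src_toFun g).symm⟩).1
  p_act e g h := ((f.toFun g).2.2 ⟨e, h.trans (f.src_toFun g).symm⟩).2.trans (f.tgt_toFun g)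
  act_one e m h := by
    have key : ∀ z, z = (fibreGroupoid p).one m → ∀ h', (z.2.2 ⟨e, h'⟩).1 = e := by
      rintro z rfl h'; rfl
    exact key _ (f.map_one m) _
  act_mul e g g' h h' := by
    have key : ∀ z hz, z = (fibreGroupoid p).mul (f.toFun g) (f.toFun g') hz → ∀ h1 h2 h3,
        (z.2.2 ⟨e, h1⟩).1 = ((f.toFun g').2.2 ⟨((f.toFun g).2.2 ⟨e, h2⟩).1, h3⟩).1 := by
      rintro z hz rfl h1 h2 h3; rfl
    exact key _ _ (f.map_mul g g' h') _ _ _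

namespace BraidedQuiver

section
variable {M : Type u} (A : BraidedQuiver M)

/-- Formal groupoid expressions in the arrows of `A`, with prescribed source and target. -/
inductive Word : M → M → Type u
  | gen (x : A.carrier) {m n : M} (hs : A.src x = m) (ht : A.tgt x = n) : Word m n
  | one (m : M) : Word m m
  | mul {m n k : M} (v : Word m n) (w : Word n k) : Word m k
  | inv {m n : M} (v : Word m n) : Word n m

variable {A} in
/-- The relations of the structure groupoid: the groupoid axioms, compatibility with the
operations, and `xy = (x ⇀ y)(x ↼ y)`. -/
inductive Rel : ∀ {m n : M}, Word A m n → Word A m n → Prop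
  | mul_left {m n k : M} {v v' : Word A m n} (w : Word A n k) : Rel v v' → Rel (v.mul w) (v'.mul w)
  | mul_right {m n k : M} (v : Word A m n) {w w' : Word A n k} : Rel w w' → Rel (v.mul w) (v.mul w')
  | inv {m n : M} {v v' : Word A m n} : Rel v v' → Rel v.inv v'.inv
  | mul_assoc {m n k l : M} (v : Word A m n) (w : Word A n k) (z : Word A k l) :
      Rel ((v.mul w).mul z) (v.mul (w.mul z))
  | one_mul {m n : M} (v : Word A m n) : Rel ((Word.one m).mul v) v
  | mul_one {m n : M} (v : Word A m n) : Rel (v.mul (Word.one n)) v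
  | mul_inv {m n : M} (v : Word A m n) : Rel (v.mul v.inv) (Word.one m)
  | inv_mul {m n : M} (v : Word A m n) : Rel (v.inv.mul v) (Word.one n)
  | braid (x y : A.carrier) (h : A.tgt x = A.src y) :
      Rel ((Word.gen x rfl rfl).mul (Word.gen y h.symm rfl))
        ((Word.gen (A.R.lact x y h) (A.R.src_lact x y h) (A.R.tgt_lact x y h)).mul
          (Word.gen (A.R.ract x y h) rfl (A.R.tgt_ract x y h)))

/-- Arrows of the structure groupoid with given source and target. -/
def Arrow (m n : M) : Type u := Quot (@Rel M A m n)

variable {A} in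
def Arrow.mul {m n k : M} : Arrow A m n → Arrow A n k → Arrow A m k :=
  Quot.map₂ Word.mul (fun v _ _ h => Rel.mul_right v h) (fun _ _ w h => Rel.mul_left w h)

/-- The structure groupoid of `A`: the groupoid generated by the quiver `A` with defining
relations `xy = (x ⇀ y)(x ↼ y)`. -/
def gpd : GroupoidOver M where
  carrier := Σ m : M, Σ n : M, Arrow A m n
  src g := g.1
  tgt g := g.2.1
  mul g g' h := ⟨g.1, g'.2.1, Arrow.mul g.2.2 (h.symm ▸ g'.2.2)⟩
  one m := ⟨m, m, Quot.mk _ (Word.one m)⟩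
  inv g := ⟨g.2.1, g.1, Quot.map Word.inv (fun _ _ h => Rel.inv h) g.2.2⟩
  src_mul _ _ _ := rfl
  tgt_mul _ _ _ := rfl
  src_one _ := rfl
  tgt_one _ := rfl
  src_inv _ := rfl
  tgt_inv _ := rfl
  mul_assoc := by
    rintro ⟨m, n, ⟨x⟩⟩ ⟨n', k, ⟨y⟩⟩ ⟨k', l, ⟨z⟩⟩ h h'
    dsimp only at h h'
    subst h h'
    exact congrArg (fun a => (⟨m, l, a⟩ : Σ m : M, Σ n : M, Arrow A m n))
      (Quot.sound (Rel.mul_assoc x y z))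
  one_mul := by
    rintro ⟨m, n, ⟨x⟩⟩
    exact congrArg (fun a => (⟨m, n, a⟩ : Σ m : M, Σ n : M, Arrow A m n))
      (Quot.sound (Rel.one_mul x))
  mul_one := by
    rintro ⟨m, n, ⟨x⟩⟩
    exact congrArg (fun a => (⟨m, n, a⟩ : Σ m : M, Σ n : M, Arrow A m n))
      (Quot.sound (Rel.mul_one x))
  mul_inv := by
    rintro ⟨m, n, ⟨x⟩⟩
    exact congrArg (fun a => (⟨m, m, a⟩ : Σ m : M, Σ n : M, Arrow A m n))
      (Quot.sound (Rel.mul_inv x))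
  inv_mul := by
    rintro ⟨m, n, ⟨x⟩⟩
    exact congrArg (fun a => (⟨n, n, a⟩ : Σ m : M, Σ n : M, Arrow A m n))
      (Quot.sound (Rel.inv_mul x))

/-- The canonical map from `A` to its structure groupoid. -/
def ι : QuiverOver.Hom A.toQuiverOver A.gpd.toQuiverOver where
  toFun x := ⟨A.src x, A.tgt x, Quot.mk _ (Word.gen x rfl rfl)⟩
  src_toFun _ := rfl
  tgt_toFun _ := rfl

variable {A} in
/-- `R (x, y) = (u, v)`. -/
def IsR (x y u v : A.carrier) : Prop :=
  ∃ h : A.tgt x = A.src y, A.R.lact x y h = u ∧ A.R.ract x y h = v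

theorem gen_eq_ι (x : A.carrier) {m n : M} (hs : A.src x = m) (ht : A.tgt x = n) :
    (⟨m, n, Quot.mk _ (Word.gen x hs ht)⟩ : A.gpd.carrier) = A.ι.toFun x := by
  subst hs ht; rfl

@[simp] theorem src_ι (x : A.carrier) : A.gpd.src (A.ι.toFun x) = A.src x := rfl
@[simp] theorem tgt_ι (x : A.carrier) : A.gpd.tgt (A.ι.toFun x) = A.tgt x := rfl

variable {A} in
theorem tι {x : A.carrier} {m : M} (h : A.tgt x = m) : A.gpd.tgt (A.ι.toFun x) = m := h
variable {A} in
theorem tιι {x y : A.carrier} (h : A.tgt x = A.src y) :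
    A.gpd.tgt (A.ι.toFun x) = A.gpd.src (A.ι.toFun y) := h
variable {A} in
theorem itι {x : A.carrier} {m : M} (h : A.gpd.tgt (A.ι.toFun x) = m) : A.tgt x = m := h

theorem gpd_ind {P : A.gpd.carrier → Prop} (gen : ∀ x, P (A.ι.toFun x))
    (one : ∀ m, P (A.gpd.one m)) (mul : ∀ g g' h, P g → P g' → P (A.gpd.mul g g' h))
    (inv : ∀ g, P g → P (A.gpd.inv g)) (g : A.gpd.carrier) : P g := by
  have key : ∀ {m n : M} (w : Word A m n), P (⟨m, n, Quot.mk _ w⟩ : A.gpd.carrier) := by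
    intro m n w
    induction w with
    | gen x hs ht => exact (A.gen_eq_ι x hs ht).symm ▸ gen x
    | one m => exact one m
    | @mul m n k v w hv hw =>
      exact mul (⟨m, n, Quot.mk _ v⟩ : A.gpd.carrier) (⟨n, k, Quot.mk _ w⟩ : A.gpd.carrier)
        rfl hv hw
    | inv v hv => exact inv _ hv
  obtain ⟨m, n, ⟨w⟩⟩ := g
  exact key w

variable {A} in
theorem IsR.mul {x y u v : A.carrier} (h : IsR x y u v)
    (h1 : A.gpd.tgt (A.ι.toFun x) = A.gpd.src (A.ι.toFun y))
    (h2 : A.gpd.tgt (A.ι.toFun u) = A.gpd.src (A.ι.toFun v)) : A.gpd.mul (A.ι.toFun x) (A.ι.toFun y) h1 =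
      A.gpd.mul (A.ι.toFun u) (A.ι.toFun v) h2 := by
  obtain ⟨h, rfl, rfl⟩ := h
  refine (A.gpd.mul_congr (h' := rfl) (A.gen_eq_ι x rfl rfl).symm
    (A.gen_eq_ι y h.symm rfl).symm).trans (Eq.trans ?_ (A.gpd.mul_congr (h := rfl)
      (A.gen_eq_ι _ (A.R.src_lact x y h) (A.R.tgt_lact x y h))
      (A.gen_eq_ι _ rfl (A.R.tgt_ract x y h))))
  exact congrArg (fun a => (⟨A.src x, A.tgt y, a⟩ : A.gpd.carrier)) (Quot.sound (Rel.braid x y h))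

section lift
variable {A} {H : GroupoidOver M} (f : QuiverOver.Hom A.toQuiverOver H.toQuiverOver)

/-- Evaluation of a word in a groupoid receiving a map from `A`. -/
def evalWord : ∀ {m n : M}, Word A m n → {z : H.carrier // H.src z = m ∧ H.tgt z = n}
  | _, _, .gen x hs ht => ⟨f.toFun x, (f.src_toFun x).trans hs, (f.tgt_toFun x).trans ht⟩
  | _, _, .one m => ⟨H.one m, H.src_one m, H.tgt_one m⟩
  | _, _, .mul v w => ⟨H.mul (evalWord v).1 (evalWord w).1
      ((evalWord v).2.2.trans (evalWord w).2.1.symm),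
      (H.src_mul _ _ _).trans (evalWord v).2.1, (H.tgt_mul _ _ _).trans (evalWord w).2.2⟩
  | _, _, .inv v => ⟨H.inv (evalWord v).1, (H.src_inv _).trans (evalWord v).2.2,
      (H.tgt_inv _).trans (evalWord v).2.1⟩

theorem evalWord_rel (hf : ∀ x y u v, IsR x y u v → ∀ h h',
    H.mul (f.toFun x) (f.toFun y) h = H.mul (f.toFun u) (f.toFun v) h') {m n : M}
    {v w : Word A m n} (h : Rel v w) : evalWord f v = evalWord f w := by
  induction h with
  | mul_left w _ ih => simp only [evalWord, ih]
  | mul_right v _ ih => simp only [evalWord, ih]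
  | inv _ ih => simp only [evalWord, ih]
  | mul_assoc v w z => exact Subtype.ext (H.mul_assoc' _ _ _ _ _)
  | one_mul v => exact Subtype.ext (H.one_mul' _ _ _)
  | mul_one v => exact Subtype.ext (H.mul_one' _ _ _)
  | mul_inv v => exact Subtype.ext ((H.mul_inv _).trans (congrArg _ (evalWord f v).2.1))
  | inv_mul v => exact Subtype.ext ((H.inv_mul _).trans (congrArg _ (evalWord f v).2.2))
  | braid x y h => exact Subtype.ext (hf x y _ _ ⟨h, rfl, rfl⟩ _ _)

/-- The universal property of the structure groupoid. -/
def lift (hf : ∀ x y u v, IsR x y u v → ∀ h h',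
    H.mul (f.toFun x) (f.toFun y) h = H.mul (f.toFun u) (f.toFun v) h') :
    GroupoidOver.Hom A.gpd H where
  toFun g := (Quot.lift (evalWord f) (fun _ _ h => evalWord_rel f hf h) g.2.2).1
  src_toFun g := (Quot.lift (evalWord f) (fun _ _ h => evalWord_rel f hf h) g.2.2).2.1
  tgt_toFun g := (Quot.lift (evalWord f) (fun _ _ h => evalWord_rel f hf h) g.2.2).2.2
  map_mul := by
    rintro ⟨m, n, ⟨x⟩⟩ ⟨n', k, ⟨y⟩⟩ h
    obtain rfl : n = n' := h
    rfl

theorem lift_ι (hf) (x : A.carrier) : (lift f hf).toFun (A.ι.toFun x) = f.toFun x := rfl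

theorem gpd_hom_ext {f g : GroupoidOver.Hom A.gpd H}
    (h : ∀ x, f.toFun (A.ι.toFun x) = g.toFun (A.ι.toFun x)) (x : A.gpd.carrier) :
    f.toFun x = g.toFun x := by
  induction x using gpd_ind with
  | gen x => exact h x
  | one m => rw [f.map_one, g.map_one]
  | mul x y hxy hx hy =>
    rw [f.map_mul, g.map_mul]
    exact H.mul_congr hx hy
  | inv x hx => rw [f.map_inv, g.map_inv, hx]

/-- A right action of the structure groupoid from an action of the generators. -/
def liftAction {E : Type u} {p : E → M}
    (a : ∀ x : A.carrier, {e : E // p e = A.src x} ≃ {e : E // p e = A.tgt x})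
    (ha : ∀ x y u v, IsR x y u v → ∀ e h0 h1 h2 h3,
      (a y ⟨(a x ⟨e, h0⟩).1, h1⟩).1 = (a v ⟨(a u ⟨e, h2⟩).1, h3⟩).1) : RightAction A.gpd p :=
  RightAction.ofHom (lift (H := fibreGroupoid p)
    { toFun := fun x => ⟨A.src x, A.tgt x, a x⟩
      src_toFun := fun _ => rfl
      tgt_toFun := fun _ => rfl }
    (fun x y u v h h1 h2 => by
      refine fibreGroupoid_ext ?_ ?_ fun e h3 h4 => ha x y u v h e _ _ _ _
      · obtain ⟨h, rfl, rfl⟩ := h; exact (A.R.src_lact x y h).symm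
      · obtain ⟨h, rfl, rfl⟩ := h; exact (A.R.tgt_ract x y h).symm))

theorem liftAction_ι {E : Type u} {p : E → M} (a) (ha) (e : E) (x : A.carrier)
    (h : p e = A.src x) :
    (liftAction (p := p) a ha).act e (A.ι.toFun x) h = (a x ⟨e, h⟩).1 := rfl

end lift
end
end BraidedQuiver

namespace BraidedQuiver
section
variable {M : Type u} {A : BraidedQuiver M}

namespace IsR
variable {x y u v : A.carrier}

theorem tgt_src (h : IsR x y u v) : A.tgt x = A.src y := h.1
theorem src_left (h : IsR x y u v) : A.src u = A.src x := by
  obtain ⟨h, rfl, rfl⟩ := h; exact A.R.src_lact x y h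
theorem tgt_right (h : IsR x y u v) : A.tgt v = A.tgt y := by
  obtain ⟨h, rfl, rfl⟩ := h; exact A.R.tgt_ract x y h
theorem mid (h : IsR x y u v) : A.tgt u = A.src v := by
  obtain ⟨h, rfl, rfl⟩ := h; exact A.R.tgt_lact x y h

theorem eq_left {u' v' : A.carrier} (h : IsR x y u v) (h' : IsR x y u' v') : u = u' := by
  obtain ⟨_, rfl, rfl⟩ := h; obtain ⟨_, rfl, rfl⟩ := h'; rfl
theorem eq_right {u' v' : A.carrier} (h : IsR x y u v) (h' : IsR x y u' v') : v = v' := by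
  obtain ⟨_, rfl, rfl⟩ := h; obtain ⟨_, rfl, rfl⟩ := h'; rfl

theorem mk (x y : A.carrier) (h : A.tgt x = A.src y) :
    IsR x y (A.R.lact x y h) (A.R.ract x y h) := ⟨h, rfl, rfl⟩

/-- The Yang-Baxter equation in relational form. -/
theorem yang_baxter {x y z a b c d e f a' b' e' c' f' d' : A.carrier}
    (h1 : IsR x y a b) (h2 : IsR b z c d) (h3 : IsR a c e f)
    (h1' : IsR y z a' b') (h2' : IsR x a' e' c') (h3' : IsR c' b' f' d') :
    e = e' ∧ f = f' ∧ d = d' := by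
  obtain ⟨h1, rfl, rfl⟩ := h1
  obtain ⟨h2, rfl, rfl⟩ := h2
  obtain ⟨h3, rfl, rfl⟩ := h3
  obtain ⟨h1', rfl, rfl⟩ := h1'
  obtain ⟨h2', rfl, rfl⟩ := h2'
  obtain ⟨h3', rfl, rfl⟩ := h3'
  have e := congrArg Subtype.val (A.yang_baxter ⟨(x, y, z), h1, h1'⟩)
  exact ⟨congrArg (fun p => p.1) e, congrArg (fun p => p.2.1) e, congrArg (fun p => p.2.2) e⟩

end IsR

variable (A)

/-- The right action `x ↼ g` of the structure groupoid on `tgt : A → M`. -/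
noncomputable def ρ : RightAction A.gpd A.tgt :=
  liftAction (p := A.tgt) (fun x => Equiv.ofBijective _ (A.bijective_right x))
    (fun x y u v h e h0 h1 h2 h3 => by
      change A.R.ract (A.R.ract e x h0) y h1 = A.R.ract (A.R.ract e u h2) v h3
      exact (IsR.yang_baxter (IsR.mk e x h0) (IsR.mk _ y h1)
        (IsR.mk _ _ ((A.R.tgt_lact _ _ _).trans (A.R.src_lact _ _ _).symm)) h (IsR.mk e u h2)
        (IsR.mk _ v h3)).2.2)

theorem ρ_ι (x y : A.carrier) (h : A.tgt x = A.src y) :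
    A.ρ.act x (A.ι.toFun y) h = A.R.ract x y h := rfl

theorem exists_isR_left (x u : A.carrier) (h : A.src x = A.src u) : ∃ y v, IsR x y u v := by
  obtain ⟨⟨y, hy⟩, e⟩ := (A.bijective_left x).2 ⟨u, h.symm⟩
  exact ⟨y, _, hy.symm, congrArg Subtype.val e, rfl⟩

theorem exists_isR_right (u v : A.carrier) (h : A.tgt u = A.src v) : ∃ x y, IsR x y u v := by
  obtain ⟨⟨⟨x, y⟩, hxy⟩, e⟩ := A.bijective_R.2 ⟨(u, v), h⟩
  exact ⟨x, y, hxy, congrArg (fun p => p.1.1) e, congrArg (fun p => p.1.2) e⟩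

variable {A} in
theorem IsR.unique_left {x y y' u v v' : A.carrier} (h : IsR x y u v) (h' : IsR x y' u v') :
    y = y' ∧ v = v' := by
  obtain ⟨h, e, rfl⟩ := h
  obtain ⟨h', e', rfl⟩ := h'
  have := @(A.bijective_left x).1 ⟨y, h.symm⟩ ⟨y', h'.symm⟩ (Subtype.ext (e.trans e'.symm))
  obtain rfl : y = y' := congrArg Subtype.val this
  exact ⟨rfl, rfl⟩

variable {A} in
theorem IsR.unique_right {x x' y y' u v : A.carrier} (h : IsR x y u v) (h' : IsR x' y' u v) :
    x = x' ∧ y = y' := by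
  obtain ⟨h, e1, e2⟩ := h
  obtain ⟨h', e1', e2'⟩ := h'
  have := @A.bijective_R.1 ⟨(x, y), h⟩ ⟨(x', y'), h'⟩
    (Subtype.ext (Prod.ext (e1.trans e1'.symm) (e2.trans e2'.symm)))
  exact ⟨congrArg (fun p => p.1.1) this, congrArg (fun p => p.1.2) this⟩

/-- The bijection sending `x` to the `v` with `R (x, y) = (u, v)` for some `y`. -/
noncomputable def δEquiv (u : A.carrier) :
    {x : A.carrier // A.src x = A.src u} ≃ {v : A.carrier // A.src v = A.tgt u} :=
  Equiv.ofBijective (fun x => ⟨(A.exists_isR_left x.1 u x.2).choose_spec.choose,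
    (A.exists_isR_left x.1 u x.2).choose_spec.choose_spec.mid.symm⟩) (by
    constructor
    · rintro ⟨x, hx⟩ ⟨x', hx'⟩ e
      have h := (A.exists_isR_left x u hx).choose_spec.choose_spec
      have h' := (A.exists_isR_left x' u hx').choose_spec.choose_spec
      have e' := congrArg Subtype.val e
      dsimp only at e'
      rw [e'] at h
      exact Subtype.ext (h.unique_right h').1
    · rintro ⟨v, hv⟩
      obtain ⟨x, y, h⟩ := A.exists_isR_right u v hv.symm
      have hx := h.src_left.symm
      refine ⟨⟨x, hx⟩, Subtype.ext ?_⟩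
      exact ((A.exists_isR_left x u hx).choose_spec.choose_spec.unique_left h).2)

theorem isR_δEquiv (x u : A.carrier) (h : A.src x = A.src u) :
    ∃ y, IsR x y u (A.δEquiv u ⟨x, h⟩).1 :=
  ⟨_, (A.exists_isR_left x u h).choose_spec.choose_spec⟩

variable {A} in
theorem IsR.δEquiv_eq {x y u v : A.carrier} (h : IsR x y u v) (h') :
    (A.δEquiv u ⟨x, h'⟩).1 = v :=
  ((A.isR_δEquiv x u h').choose_spec.unique_left h).2

/-- The right action of the structure groupoid on `src : A → M` sending `x, x ⇀ h` to
`x ↼ h`. -/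
noncomputable def δ : RightAction A.gpd A.src :=
  liftAction (p := A.src) A.δEquiv (fun u1 u2 w1 w2 h x h0 h1 h2 h3 => by
    obtain ⟨y1, k1⟩ := A.isR_δEquiv x u1 h0
    obtain ⟨y2, k2⟩ := A.isR_δEquiv _ u2 h1
    have k3 := IsR.mk y1 y2 (k1.tgt_right.symm.trans k2.tgt_src)
    have k4 := IsR.mk x _ (k1.tgt_src.trans k3.src_left.symm)
    have k5 := IsR.mk _ _ (k4.tgt_right.trans k3.mid)
    obtain ⟨e1, e2, e3⟩ := IsR.yang_baxter k1 k2 h k3 k4 k5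
    rw [← e1] at k4
    rw [← e2, ← e3] at k5
    have e4 := k4.δEquiv_eq h2
    have := k5.δEquiv_eq (k5.src_left.symm)
    rw [← this]
    simp only [e4])

theorem δ_ι {x y u v : A.carrier} (h : IsR x y u v) (h') :
    A.δ.act x (A.ι.toFun u) h' = v := h.δEquiv_eq h'

@[simp] theorem tgt_ρ (x g h) : A.tgt (A.ρ.act x g h) = A.gpd.tgt g := A.ρ.p_act x g h
@[simp] theorem src_δ (x g h) : A.src (A.δ.act x g h) = A.gpd.tgt g := A.δ.p_act x g h

/-- The left action `x ⇀ g = x g (x ↼ g)⁻¹` of a generator. -/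
noncomputable def μ (x : A.carrier) (g : A.gpd.carrier) (h : A.tgt x = A.gpd.src g) :
    A.gpd.carrier :=
  A.gpd.mul (A.gpd.mul (A.ι.toFun x) g (tι h)) (A.gpd.inv (A.ι.toFun (A.ρ.act x g h))) (by simp)

/-- The inverse `x⁻¹ g (δ x g)` of `μ x`. -/
noncomputable def ν (x : A.carrier) (g : A.gpd.carrier) (h : A.src x = A.gpd.src g) :
    A.gpd.carrier :=
  A.gpd.mul (A.gpd.mul (A.gpd.inv (A.ι.toFun x)) g (by simpa using h))
    (A.ι.toFun (A.δ.act x g h)) (by simp)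

@[simp] theorem src_μ (x g h) : A.gpd.src (A.μ x g h) = A.src x := by simp [μ]
@[simp] theorem tgt_μ (x g h) : A.gpd.tgt (A.μ x g h) = A.src (A.ρ.act x g h) := by simp [μ]
@[simp] theorem src_ν (x g h) : A.gpd.src (A.ν x g h) = A.tgt x := by simp [ν]
@[simp] theorem tgt_ν (x g h) : A.gpd.tgt (A.ν x g h) = A.tgt (A.δ.act x g h) := by simp [ν]

theorem μ_congr {x x' g g'} (e : x = x') (e' : g = g') {h h'} : A.μ x g h = A.μ x' g' h' := by
  subst e e'; rfl

theorem ν_congr {x x' g g'} (e : x = x') (e' : g = g') {h h'} : A.ν x g h = A.ν x' g' h' := by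
  subst e e'; rfl

theorem ι_congr {x x'} (e : x = x') : A.ι.toFun x = A.ι.toFun x' := congrArg _ e

theorem μ_mul_ρ (x g h) : A.gpd.mul (A.μ x g h) (A.ι.toFun (A.ρ.act x g h)) (by simp) =
    A.gpd.mul (A.ι.toFun x) g (tι h) := by
  simp [μ]

theorem eq_μ {x g h y h'} (e : A.gpd.mul y (A.ι.toFun (A.ρ.act x g h)) h' =
    A.gpd.mul (A.ι.toFun x) g (tι h)) : y = A.μ x g h :=
  A.gpd.mul_right_cancel (e.trans (A.μ_mul_ρ x g h).symm)

theorem mul_ν (x g h) : A.gpd.mul (A.ι.toFun x) (A.ν x g h) (by simp) =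
    A.gpd.mul g (A.ι.toFun (A.δ.act x g h)) (by simp) := by
  simp [ν]

theorem eq_ν {x g h y h'} (e : A.gpd.mul (A.ι.toFun x) y h' =
    A.gpd.mul g (A.ι.toFun (A.δ.act x g h)) (by simp)) : y = A.ν x g h :=
  A.gpd.mul_left_cancel (e.trans (A.mul_ν x g h).symm)

theorem μ_ι (x y h) : A.μ x (A.ι.toFun y) h = A.ι.toFun (A.R.lact x y h) :=
  (A.eq_μ (h' := tιι (A.R.tgt_lact x y h)) ((IsR.mk x y h).mul _ _).symm).symm

theorem ν_ι {x y u v : A.carrier} (k : IsR x y u v) (h) :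
    A.ν x (A.ι.toFun u) h = A.ι.toFun y := by
  refine (A.eq_ν (h' := tιι k.tgt_src) ?_).symm
  refine (k.mul (tιι k.tgt_src) (tιι k.mid)).trans ?_
  exact A.gpd.mul_congr rfl (A.ι_congr (A.δ_ι k h).symm)

theorem μ_one (x m h) : A.μ x (A.gpd.one m) h = A.gpd.one (A.src x) := by
  refine (A.eq_μ (h' := by simp [A.ρ.act_one]) ?_).symm
  simp [A.ρ.act_one]

theorem ν_one (x m h) : A.ν x (A.gpd.one m) h = A.gpd.one (A.tgt x) := by
  refine (A.eq_ν (h' := by simp) ?_).symm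
  exact (A.gpd.mul_one' _ _ _).trans
    ((A.ι_congr (A.δ.act_one x m h)).symm.trans (A.gpd.one_mul' m _ _).symm)

theorem μ_mul (x g g') (h : A.tgt x = A.gpd.src g) (h') (h'') :
    A.μ x (A.gpd.mul g g' h') h'' = A.gpd.mul (A.μ x g h)
      (A.μ (A.ρ.act x g h) g' ((A.tgt_ρ _ _ _).trans h')) (by simp) := by
  have e := A.ρ.act_mul x g g' h h'
  refine (A.eq_μ (h' := by simp [e]) ?_).symm
  simp only [e]
  simp only [GroupoidOver.mul_assoc', μ_mul_ρ]
  have := A.μ_mul_ρ x g h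
  rw [← A.gpd.mul_assoc _ _ _ (by simp)]
  simp only [this]
  simp

theorem ν_mul (x g g') (h : A.src x = A.gpd.src g) (h') (h'') :
    A.ν x (A.gpd.mul g g' h') h'' = A.gpd.mul (A.ν x g h)
      (A.ν (A.δ.act x g h) g' ((A.src_δ _ _ _).trans h')) (by simp) := by
  have e := A.δ.act_mul x g g' h h'
  refine (A.eq_ν (h' := by simp) ?_).symm
  simp only [e]
  have := A.mul_ν x g h
  rw [← A.gpd.mul_assoc _ _ _ (by simp)]
  simp only [this, GroupoidOver.mul_assoc', mul_ν]

theorem μ_inv (x g h) (h') : A.μ x (A.gpd.inv g) h =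
    A.gpd.inv (A.μ (A.ρ.act x (A.gpd.inv g) h) g h') := by
  refine A.gpd.eq_inv_of_mul (m := A.src x) (h := by simp) ?_
  rw [← A.μ_mul x (A.gpd.inv g) g h (by simp) (by simpa using h)]
  exact (A.μ_congr rfl (A.gpd.inv_mul g) (h' := by simpa using h)).trans (A.μ_one _ _ _)

theorem ν_inv (x g h) (h') : A.ν x (A.gpd.inv g) h =
    A.gpd.inv (A.ν (A.δ.act x (A.gpd.inv g) h) g h') := by
  refine A.gpd.eq_inv_of_mul (m := A.tgt x) (h := by simp) ?_
  rw [← A.ν_mul x (A.gpd.inv g) g h (by simp) (by simpa using h)]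
  exact (A.ν_congr rfl (A.gpd.inv_mul g) (h' := by simpa using h)).trans (A.ν_one _ _ _)

theorem ρ_ν (g : A.gpd.carrier) : ∀ x h h', A.ρ.act x (A.ν x g h) h' = A.δ.act x g h := by
  induction g using gpd_ind with
  | gen u =>
    intro x h h'
    obtain ⟨y, v, k⟩ := A.exists_isR_left x u h
    rw [A.δ_ι k]
    refine (A.ρ.act_congr rfl (A.ν_ι k h) (h' := k.tgt_src)).trans ?_
    obtain ⟨_, _, e⟩ := k
    exact e
  | one m =>
    intro x h h'
    rw [A.δ.act_one]
    exact (A.ρ.act_congr rfl (A.ν_one x m h) (h' := by simp)).trans (A.ρ.act_one _ _ _)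
  | mul g g' hg ih ih' =>
    intro x h h'
    have h0 : A.src x = A.gpd.src g := by simpa using h
    rw [A.δ.act_mul x g g' h0]
    refine (A.ρ.act_congr rfl (A.ν_mul x g g' h0 hg h) (h' := by simp)).trans ?_
    rw [A.ρ.act_mul _ _ _ (by simp) (by simp)]
    refine (A.ρ.act_congr (ih x h0 (by simp)) rfl (h' := by simp)).trans (ih' _ _ _)
  | inv g ih =>
    intro x h h'
    have h0 : A.src (A.δ.act x (A.gpd.inv g) h) = A.gpd.src g := by simp
    have e := ih (A.δ.act x (A.gpd.inv g) h) h0 (by simp)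
    rw [A.δ.act_inv_act] at e
    refine (A.ρ.act_congr e.symm (A.ν_inv x g h h0) (h' := by simp)).trans ?_
    simp

theorem δ_μ (g : A.gpd.carrier) : ∀ x h h', A.δ.act x (A.μ x g h) h' = A.ρ.act x g h := by
  induction g using gpd_ind with
  | gen y =>
    intro x h h'
    exact (A.δ.act_congr rfl (A.μ_ι x y h) (h' := (A.R.src_lact _ _ _).symm)).trans
      (A.δ_ι (IsR.mk x y h) _)
  | one m =>
    intro x h h'
    rw [A.ρ.act_one]
    exact (A.δ.act_congr rfl (A.μ_one x m h) (h' := by simp)).trans (A.δ.act_one _ _ _)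
  | mul g g' hg ih ih' =>
    intro x h h'
    have h0 : A.tgt x = A.gpd.src g := by simpa using h
    rw [A.ρ.act_mul x g g' h0]
    refine (A.δ.act_congr rfl (A.μ_mul x g g' h0 hg h) (h' := by simp)).trans ?_
    rw [A.δ.act_mul _ _ _ (by simp) (by simp)]
    refine (A.δ.act_congr (ih x h0 (by simp)) rfl (h' := by simp)).trans (ih' _ _ _)
  | inv g ih =>
    intro x h h'
    have h0 : A.tgt (A.ρ.act x (A.gpd.inv g) h) = A.gpd.src g := by simp
    have e := ih (A.ρ.act x (A.gpd.inv g) h) h0 (by simp)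
    rw [A.ρ.act_inv_act] at e
    refine (A.δ.act_congr e.symm (A.μ_inv x g h h0) (h' := by simp)).trans ?_
    simp

theorem μ_ν (x g h h') : A.μ x (A.ν x g h) h' = g := by
  have e := A.ρ_ν g x h h'
  refine (A.eq_μ (h' := by simp [e]) ?_).symm
  simp only [e, mul_ν]

theorem ν_μ (x g h h') : A.ν x (A.μ x g h) h' = g := by
  have e := A.δ_μ g x h h'
  refine (A.eq_ν (h' := h) ?_).symm
  simp only [e, μ_mul_ρ]

/-- `μ x` as a bijection. -/
noncomputable def μEquiv (x : A.carrier) :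
    {g : A.gpd.carrier // A.gpd.src g = A.tgt x} ≃ {g : A.gpd.carrier // A.gpd.src g = A.src x} where
  toFun g := ⟨A.μ x g.1 g.2.symm, by simp⟩
  invFun g := ⟨A.ν x g.1 g.2.symm, by simp⟩
  left_inv g := Subtype.ext (A.ν_μ _ _ _ _)
  right_inv g := Subtype.ext (A.μ_ν _ _ _ _)

theorem isR_ρ (g : A.gpd.carrier) : ∀ x y u v : A.carrier, IsR x y u v →
    ∀ (h2 : A.tgt y = A.gpd.src g) (h1 : A.tgt x = A.gpd.src (A.μ y g h2))
    (h4 : A.tgt v = A.gpd.src g) (h3 : A.tgt u = A.gpd.src (A.μ v g h4)),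
    IsR (A.ρ.act x (A.μ y g h2) h1) (A.ρ.act y g h2) (A.ρ.act u (A.μ v g h4) h3)
      (A.ρ.act v g h4) := by
  induction g using gpd_ind with
  | gen z =>
    intro x y u v k h2 h1 h4 h3
    have e1 := A.ρ.act_congr rfl (A.μ_ι y z h2) (h := h1)
      (h' := k.tgt_src.trans (A.R.src_lact _ _ _).symm)
    have e2 := A.ρ.act_congr rfl (A.μ_ι v z h4) (h := h3)
      (h' := k.mid.trans (A.R.src_lact _ _ _).symm)
    rw [e1, e2]
    have a1 := IsR.mk y z h2
    have a2 := IsR.mk x _ (k.tgt_src.trans a1.src_left.symm)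
    have a3 := IsR.mk _ _ (a2.tgt_right.trans a1.mid)
    have b1 := IsR.mk v z h4
    have b2 := IsR.mk u _ (k.mid.trans b1.src_left.symm)
    obtain ⟨c1, c2, c3⟩ := IsR.yang_baxter k b1 b2 a1 a2 a3
    have a4 := a3
    rw [← c2, ← c3] at a4
    exact a4
  | one m =>
    intro x y u v k h2 h1 h4 h3
    have e1 := (A.ρ.act_congr rfl (A.μ_one y m h2) (h := h1)
      (h' := by simpa using k.tgt_src)).trans (A.ρ.act_one _ _ _)
    have e2 := (A.ρ.act_congr rfl (A.μ_one v m h4) (h := h3)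
      (h' := by simpa using k.mid)).trans (A.ρ.act_one _ _ _)
    rw [e1, e2, A.ρ.act_one, A.ρ.act_one]
    exact k
  | mul g g' hg ih ih' =>
    intro x y u v k h2 h1 h4 h3
    have h2' : A.tgt y = A.gpd.src g := by simpa using h2
    have h4' : A.tgt v = A.gpd.src g := by simpa using h4
    have key : ∀ (x y : A.carrier) (h2 : A.tgt y = A.gpd.src (A.gpd.mul g g' hg))
        (h1 : A.tgt x = A.gpd.src (A.μ y (A.gpd.mul g g' hg) h2)) (h2' : A.tgt y = A.gpd.src g) (h5 h6 h7),
        A.ρ.act x (A.μ y (A.gpd.mul g g' hg) h2) h1 =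
        A.ρ.act (A.ρ.act x (A.μ y g h2') h5) (A.μ (A.ρ.act y g h2') g' h6) h7 := by
      intro x y h2 h1 h2' h5 h6 h7
      refine (A.ρ.act_congr rfl (A.μ_mul y g g' h2' hg h2) (h' := by simpa using h5)).trans ?_
      exact A.ρ.act_mul _ _ _ _ _
    rw [key x y h2 h1 h2' (by simpa using k.tgt_src) (by simp [hg]) (by simp),
      key u v h4 h3 h4' (by simpa using k.mid) (by simp [hg]) (by simp),
      A.ρ.act_mul y g g' h2' hg, A.ρ.act_mul v g g' h4' hg]
    exact ih' _ _ _ _ (ih x y u v k _ _ _ _) _ _ _ _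
  | inv g ih =>
    intro x y u v k h2 h1 h4 h3
    set y0 := A.ρ.act y (A.gpd.inv g) h2 with hy0
    set x0 := A.ρ.act x (A.μ y (A.gpd.inv g) h2) h1 with hx0
    have hy0' : A.tgt y0 = A.gpd.src g := by simp [hy0]
    have k0 := IsR.mk x0 y0 (by simp [hx0, hy0])
    set u0 := A.R.lact x0 y0 (by simp [hx0, hy0])
    set v0 := A.R.ract x0 y0 (by simp [hx0, hy0])
    have hv0 : A.tgt v0 = A.gpd.src g := k0.tgt_right.trans hy0'
    have hu0 : A.tgt u0 = A.gpd.src (A.μ v0 g hv0) := by simpa using k0.mid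
    have hx0' : A.tgt x0 = A.gpd.src (A.μ y0 g hy0') := by simpa using k0.tgt_src
    have i := ih x0 y0 u0 v0 k0 hy0' hx0' hv0 hu0
    have ey : A.ρ.act y0 g hy0' = y := by simp [hy0]
    have ex : A.ρ.act x0 (A.μ y0 g hy0') hx0' = x := by
      have e := A.μ_inv y g h2 hy0'
      have := A.ρ.act_act_inv x (A.μ y (A.gpd.inv g) h2) h1 (by simp)
      refine Eq.trans (A.ρ.act_congr rfl ?_) this
      rw [e, GroupoidOver.inv_inv]
    rw [ey, ex] at i
    have eu := k.eq_left i
    have ev := k.eq_right i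
    have ev0 : A.ρ.act v (A.gpd.inv g) h4 = v0 := by
      refine (A.ρ.act_congr ev rfl (h' := by simp)).trans ?_
      simp
    have eu0 : A.ρ.act u (A.μ v (A.gpd.inv g) h4) h3 = u0 := by
      have e := A.μ_inv v g h4 (by simp)
      have e' : A.μ v (A.gpd.inv g) h4 = A.gpd.inv (A.μ v0 g hv0) := by
        rw [e]; exact congrArg _ (A.μ_congr ev0 rfl)
      refine (A.ρ.act_congr eu e' (h' := by simp)).trans ?_
      simp
    rw [eu0, ev0]
    exact k0

theorem μ_μ {x y u v : A.carrier} (k : IsR x y u v) (g : A.gpd.carrier) (h2 : A.tgt y = A.gpd.src g)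
    (h1 : A.tgt x = A.gpd.src (A.μ y g h2)) (h4 : A.tgt v = A.gpd.src g)
    (h3 : A.tgt u = A.gpd.src (A.μ v g h4)) :
    A.μ x (A.μ y g h2) h1 = A.μ u (A.μ v g h4) h3 := by
  have i := A.isR_ρ g x y u v k h2 h1 h4 h3
  have key : ∀ x y (h2 : A.tgt y = A.gpd.src g) (h1 : A.tgt x = A.gpd.src (A.μ y g h2))
      (h : A.tgt x = A.src y) h5, A.gpd.mul (A.μ x (A.μ y g h2) h1)
      (A.gpd.mul (A.ι.toFun (A.ρ.act x (A.μ y g h2) h1)) (A.ι.toFun (A.ρ.act y g h2)) h5)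
      (by simp) = A.gpd.mul (A.gpd.mul (A.ι.toFun x) (A.ι.toFun y) (tιι h)) g (by simpa using h2) := by
    intro x y h2 h1 h h5
    rw [← A.gpd.mul_assoc _ _ _ (by simp) h5]
    simp only [μ_mul_ρ, GroupoidOver.mul_assoc']
  have e1 := key x y h2 h1 k.tgt_src (tιι i.tgt_src)
  have e2 := key u v h4 h3 k.mid (tιι i.mid)
  simp only [← k.mul (tιι k.tgt_src) (tιι k.mid), ← i.mul (tιι i.tgt_src) (tιι i.mid)] at e2
  exact A.gpd.mul_right_cancel (e1.trans e2.symm)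

/-- The left action of the structure groupoid on itself, as a right action of inverses. -/
noncomputable def leftAction : RightAction A.gpd A.gpd.src :=
  liftAction (p := A.gpd.src) (fun x => (A.μEquiv x).symm)
    (fun x y u v k e h0 h1 h2 h3 => by
      have h1' : A.src y = A.gpd.src (A.ν x e h0.symm) := h1.symm
      have h3' : A.src v = A.gpd.src (A.ν u e h2.symm) := h3.symm
      change A.ν y (A.ν x e h0.symm) h1' = A.ν v (A.ν u e h2.symm) h3'
      have h4 : A.tgt v = A.gpd.src (A.ν y (A.ν x e h0.symm) h1') := by
        rw [src_ν]; exact k.tgt_right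
      have e1 := A.μ_μ k (A.ν y (A.ν x e h0.symm) h1') (by simp) (by simpa using k.tgt_src) h4
        (by simpa using k.mid)
      have e2 : A.μ y (A.ν y (A.ν x e h0.symm) h1') (by simp) = A.ν x e h0.symm :=
        A.μ_ν _ _ _ _
      simp only [e2, A.μ_ν] at e1
      have e3 := A.ν_congr rfl e1 (h := h2.symm) (h' := by simp)
      rw [A.ν_μ] at e3
      refine ((A.ν_congr rfl e3 (h' := by simpa using k.tgt_right.symm.symm)).trans
        (A.ν_μ _ _ h4 _)).symm)

/-- `g ⇀ h` in the structure groupoid. -/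
noncomputable def L (g h : A.gpd.carrier) (hgh : A.gpd.tgt g = A.gpd.src h) : A.gpd.carrier :=
  A.leftAction.act h (A.gpd.inv g) (by simp [hgh])

theorem L_congr {g g' h h'} (e : g = g') (e' : h = h') {k k'} : A.L g h k = A.L g' h' k' := by
  subst e e'; rfl

@[simp] theorem src_L (g h k) : A.gpd.src (A.L g h k) = A.gpd.src g := by
  rw [L, A.leftAction.p_act]; simp

theorem L_ι (x : A.carrier) (h k) : A.L (A.ι.toFun x) h k = A.μ x h (itι k) := by
  replace k := itι k
  have e : A.leftAction.act (A.μ x h k) (A.ι.toFun x) (by simp) = h := A.ν_μ _ _ _ _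
  have e' := A.leftAction.act_act_inv (A.μ x h k) (A.ι.toFun x) (by simp) (by simp [e, ← k])
  rw [← e']
  exact A.leftAction.act_congr e.symm rfl

theorem one_L (m h k) : A.L (A.gpd.one m) h k = h := by
  refine (A.leftAction.act_congr rfl (A.gpd.inv_one m) (h' := by simpa using k.symm)).trans ?_
  exact A.leftAction.act_one _ _ _

theorem L_L (g g' h k k' k'') : A.L g (A.L g' h k') k'' =
    A.L (A.gpd.mul g g' k) h (by simpa using k') := by
  refine Eq.trans ?_ (A.leftAction.act_congr rfl (A.gpd.inv_mul_rev g g' k)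
    (h := by simp [k']) (h' := by simp [k'])).symm
  exact (A.leftAction.act_mul _ _ _ _ _).symm

theorem L_one (g : A.gpd.carrier) : ∀ m k, A.L g (A.gpd.one m) k = A.gpd.one (A.gpd.src g) := by
  induction g using gpd_ind with
  | gen x => intro m k; rw [L_ι, μ_one]; rfl
  | one m => intro m' k; rw [one_L]; simp at k; simp [k]
  | mul g g' hg ih ih' =>
    intro m k
    have k' : A.gpd.tgt g' = A.gpd.src (A.gpd.one m) := by simpa using k
    rw [← A.L_L g g' _ hg k' (by simpa using hg)]
    refine (A.L_congr rfl (ih' m k') (k' := by simpa using hg)).trans ?_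
    rw [ih]; simp
  | inv g ih =>
    intro m k
    have e := A.L_L (A.gpd.inv g) g (A.gpd.one (A.gpd.tgt g)) (by simp) (by simp) (by simp)
    have e1 := A.L_congr (g := A.gpd.inv g) rfl (ih (A.gpd.tgt g) (by simp)) (k := by simp)
      (k' := by simp)
    have hm : m = A.gpd.src g := by simpa using k.symm
    subst hm
    rw [← e1, e]
    refine (A.L_congr (A.gpd.inv_mul g) rfl (k' := by simp)).trans ?_
    rw [one_L]; simp

theorem L_mul (g : A.gpd.carrier) : ∀ h h' k k' k1 k2 k3 k4 k5,
    A.L g (A.gpd.mul h h' k') k1 = A.gpd.mul (A.L g h k)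
      (A.L (A.gpd.mul (A.gpd.inv (A.L g h k)) (A.gpd.mul g h k2) k3) h' k4) k5 := by
  induction g using gpd_ind with
  | gen x =>
    intro h h' k k' k1 k2 k3 k4 k5
    have h0 : A.tgt x = A.gpd.src h := itι k
    rw [L_ι, A.μ_mul x h h' h0 k']
    refine A.gpd.mul_congr (A.L_ι x h k).symm
      ((A.L_ι _ h' (tι ((A.tgt_ρ x h h0).trans k'))).symm.trans (A.L_congr ?_ rfl))
    apply A.gpd.mul_left_cancel (x := A.μ x h h0) (h := by simp)
      (h' := by simp [L_ι])
    rw [μ_mul_ρ]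
    simp [L_ι]
  | one m =>
    intro h h' k k' k1 k2 k3 k4 k5
    rw [one_L]
    refine A.gpd.mul_congr (A.one_L _ _ _).symm ?_
    refine ((A.L_congr ?_ rfl (k' := by simpa using k')).trans (A.one_L (A.gpd.tgt h) h' _)).symm
    simp [one_L]
  | mul g g' hg ih ih' =>
    intro h h' k k' k1 k2 k3 k4 k5
    have j : A.gpd.tgt g' = A.gpd.src h := by simpa using k
    rw [← A.L_L g g' _ hg (by simpa using j) (by simpa using hg)]
    refine (A.L_congr rfl (ih' h h' j k' (by simpa using j) j (by simp) (by simpa using k')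
      (by simp)) (k' := by simpa using hg)).trans ?_
    refine (ih _ _ (by simpa using hg) _ _ (by simpa using hg) (by simp) (by simp) (by simp)).trans ?_
    have e := A.L_L g g' h hg j (by simpa using hg)
    refine A.gpd.mul_congr e ?_
    rw [A.L_L _ _ _ (by simp) (by simpa using k') (by simp)]
    refine A.L_congr ?_ rfl
    simp only [← e]
    simp
  | inv g ih =>
    intro h h' k k' k1 k2 k3 k4 k5
    have inj : ∀ a b ka kb, A.L g a ka = A.L g b kb → a = b := by
      intro a b ka kb e
      have := A.L_congr (g := A.gpd.inv g) rfl e (k := by simp) (k' := by simp)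
      rw [A.L_L _ _ _ (by simp) ka, A.L_L _ _ _ (by simp) kb] at this
      have e1 : ∀ a (ka : A.gpd.tgt g = A.gpd.src a) k0,
          A.L (A.gpd.mul (A.gpd.inv g) g (by simp)) a k0 = a := fun a ka k0 =>
        (A.L_congr (A.gpd.inv_mul g) rfl (k' := by simpa using ka)).trans (A.one_L _ _ _)
      rwa [e1 a ka, e1 b kb] at this
    have e1 : ∀ a (ka : A.gpd.src g = A.gpd.src a) k0 k1,
        A.L g (A.L (A.gpd.inv g) a k0) k1 = a := by
      intro a ka k0 k1
      rw [A.L_L _ _ _ (by simp) k0]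
      exact (A.L_congr (A.gpd.mul_inv g) rfl (k' := by simpa using ka)).trans (A.one_L _ _ _)
    have j : A.gpd.src g = A.gpd.src h := by simpa using k
    apply inj _ _ (by simp) (by simp)
    rw [e1 _ (by simpa using j), ih _ _ (by simp) _ _ (by simp) (by simp) (by simp) (by simp)]
    have e2 := e1 h j k (by simp)
    refine A.gpd.mul_congr e2.symm ?_
    rw [A.L_L _ _ _ (by simp) k4]
    refine ((A.L_congr ?_ rfl (k' := by simpa using k')).trans (A.one_L (A.gpd.tgt h) h' _)).symm
    simp [e2]

/-- The structure groupoid with the braiding that extends `R`. -/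
noncomputable def structureGroupoid : BraidedGroupoid M :=
  BraidedGroupoid.ofLact A.gpd A.L A.src_L A.one_L (fun m x h => A.L_one x m h)
    (fun x y z h h' => A.L_L x y z h h' _) (fun x y z h h' => A.L_mul x y z h h' _ _ _ _ _)

end
end BraidedQuiver

namespace BraidedQuiver
section
variable {M : Type u} {A : BraidedQuiver M}

theorem ract_ι_of_lact {H : BraidedGroupoid M} (φ : GroupoidOver.Hom A.gpd H.toGroupoidOver)
    (hφ : ∀ x y (h : A.tgt x = A.src y) h', φ.toFun (A.ι.toFun (A.R.lact x y h)) =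
      H.σ.lact (φ.toFun (A.ι.toFun x)) (φ.toFun (A.ι.toFun y)) h') (x y : A.carrier)
    (h : A.tgt x = A.src y) (h') : φ.toFun (A.ι.toFun (A.R.ract x y h)) =
      H.σ.ract (φ.toFun (A.ι.toFun x)) (φ.toFun (A.ι.toFun y)) h' := by
  have e := congrArg φ.toFun ((IsR.mk x y h).mul (tιι h) (tιι (A.R.tgt_lact x y h)))
  rw [φ.map_mul, φ.map_mul] at e
  simp only [hφ x y h h'] at e
  exact H.mul_left_cancel (e.symm.trans (H.lact_mul_ract _ _ h').symm)

theorem map_ρ {H : BraidedGroupoid M} (φ : GroupoidOver.Hom A.gpd H.toGroupoidOver)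
    (hφ : ∀ x y (h : A.tgt x = A.src y) h', φ.toFun (A.ι.toFun (A.R.lact x y h)) =
      H.σ.lact (φ.toFun (A.ι.toFun x)) (φ.toFun (A.ι.toFun y)) h') (g : A.gpd.carrier) :
    ∀ (x : A.carrier) (h : A.tgt x = A.gpd.src g) (h'), φ.toFun (A.ι.toFun (A.ρ.act x g h)) =
      H.σ.ract (φ.toFun (A.ι.toFun x)) (φ.toFun g) h' := by
  induction g using gpd_ind with
  | gen y => intro x h h'; exact ract_ι_of_lact φ hφ x y h h'
  | one m =>
    intro x h h'
    rw [A.ρ.act_one]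
    refine ((H.σ.ract_congr rfl (φ.map_one m) (h' := ?_)).trans (H.ract_one' m _ _)).symm
    rw [← φ.map_one]; exact h'
  | mul g g' hg ih ih' =>
    intro x h h'
    have h0 : A.tgt x = A.gpd.src g := by simpa using h
    have h1 : H.tgt (φ.toFun (A.ι.toFun x)) = H.src (φ.toFun g) := by
      rw [φ.tgt_toFun, φ.src_toFun]; exact h0
    have h2 : H.tgt (φ.toFun g) = H.src (φ.toFun g') := by
      rw [φ.tgt_toFun, φ.src_toFun]; exact hg
    rw [A.ρ.act_mul x g g' h0 hg]
    refine (ih' _ (by simpa using hg) (by rw [φ.tgt_toFun, φ.src_toFun]; simpa using hg)).trans ?_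
    refine (H.σ.ract_congr (ih x h0 h1) rfl (h' := by simpa using h2)).trans ?_
    refine (H.ract_ract _ _ _ h1 h2).trans ?_
    exact H.σ.ract_congr rfl (φ.map_mul g g' hg).symm
  | inv g ih =>
    intro x h h'
    have h0 : A.tgt (A.ρ.act x (A.gpd.inv g) h) = A.gpd.src g := by simp
    have e := ih _ h0 (by rw [φ.tgt_toFun, φ.src_toFun]; exact h0)
    rw [A.ρ.act_inv_act] at e
    refine Eq.trans ?_ (H.σ.ract_congr e.symm (φ.map_inv g).symm
      (h := by simp))
    simp

/-- A groupoid homomorphism out of the structure groupoid that is compatible with the left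
actions on generators is compatible with the left actions. -/
theorem map_L {H : BraidedGroupoid M} (φ : GroupoidOver.Hom A.gpd H.toGroupoidOver)
    (hφ : ∀ x y (h : A.tgt x = A.src y) h', φ.toFun (A.ι.toFun (A.R.lact x y h)) =
      H.σ.lact (φ.toFun (A.ι.toFun x)) (φ.toFun (A.ι.toFun y)) h') (g : A.gpd.carrier) :
    ∀ (k : A.gpd.carrier) (h : A.gpd.tgt g = A.gpd.src k) (h'), φ.toFun (A.L g k h) =
      H.σ.lact (φ.toFun g) (φ.toFun k) h' := by
  have hH : ∀ {g k}, A.gpd.tgt g = A.gpd.src k → H.tgt (φ.toFun g) = H.src (φ.toFun k) := by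
    intro g k h
    rw [φ.tgt_toFun, φ.src_toFun]; exact h
  induction g using gpd_ind with
  | gen x =>
    intro k h h'
    rw [L_ι]
    have e := congrArg φ.toFun (A.μ_mul_ρ x k (itι h))
    have e' := (φ.map_mul _ _ _).symm.trans (e.trans (φ.map_mul _ _ _))
    simp only [map_ρ φ hφ k x (itι h) h'] at e'
    exact H.mul_right_cancel (e'.trans (H.lact_mul_ract _ _ h').symm)
  | one m =>
    intro k h h'
    rw [one_L]
    refine ((H.σ.lact_congr (φ.map_one m) rfl (h' := ?_)).trans (H.one_lact' m _ _)).symm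
    rw [← φ.map_one]; exact h'
  | mul g g' hg ih ih' =>
    intro k h h'
    have j : A.gpd.tgt g' = A.gpd.src k := by simpa using h
    rw [← A.L_L g g' k hg j (by simpa using hg)]
    refine (ih _ _ (hH (by simpa using hg))).trans ?_
    refine (H.σ.lact_congr rfl (ih' k j (hH j)) (h' := by simpa using hH hg)).trans ?_
    refine (H.lact_lact _ _ _ (hH hg) (hH j)).trans ?_
    exact H.σ.lact_congr (φ.map_mul g g' hg).symm rfl
  | inv g ih =>
    intro k h h'
    have j : A.gpd.src g = A.gpd.src k := by simpa using h
    have e0 : A.L g (A.L (A.gpd.inv g) k h) (by simp) = k := by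
      rw [A.L_L _ _ _ (by simp) h]
      exact (A.L_congr (A.gpd.mul_inv g) rfl (k' := by simpa using j)).trans (A.one_L _ _ _)
    have e := ih (A.L (A.gpd.inv g) k h) (by simp) (hH (by simp))
    rw [e0] at e
    refine Eq.trans ?_ (H.σ.lact_congr (φ.map_inv g).symm e.symm (h := by simp))
    simp

/-- The braiding of the structure groupoid extends `R`. -/
theorem lact_ι (x y : A.carrier) (h : A.tgt x = A.src y) :
    A.structureGroupoid.σ.lact (A.ι.toFun x) (A.ι.toFun y) (tιι h) =
      A.ι.toFun (A.R.lact x y h) :=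
  (A.L_ι x (A.ι.toFun y) (tιι h)).trans (A.μ_ι x y h)

theorem ract_ι (x y : A.carrier) (h : A.tgt x = A.src y) :
    A.structureGroupoid.σ.ract (A.ι.toFun x) (A.ι.toFun y) (tιι h) =
      A.ι.toFun (A.R.ract x y h) :=
  (ract_ι_of_lact (H := A.structureGroupoid)
    ⟨⟨id, fun _ => rfl, fun _ => rfl⟩, fun _ _ _ => rfl⟩
    (fun x y h _ => (lact_ι x y h).symm) x y h _).symm

/-- The homomorphism of structure groupoids induced by a homomorphism of braided quivers. -/
noncomputable def mapStructureGroupoid {B : BraidedQuiver M} (f : Hom A B) :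
    BraidedGroupoid.Hom A.structureGroupoid B.structureGroupoid :=
  have hR : ∀ x y (h : A.tgt x = A.src y), IsR (f.toFun x) (f.toFun y)
      (f.toFun (A.R.lact x y h)) (f.toFun (A.R.ract x y h)) := fun x y h =>
    ⟨by rw [f.tgt_toFun, f.src_toFun]; exact h,
      (congrArg (fun p => p.1.1) (f.comm ⟨(x, y), h⟩)).symm,
      (congrArg (fun p => p.1.2) (f.comm ⟨(x, y), h⟩)).symm⟩
  BraidedGroupoid.Hom.ofLact
    (lift
      { toFun := fun x => B.ι.toFun (f.toFun x)
        src_toFun := f.src_toFun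
        tgt_toFun := f.tgt_toFun }
      (by
        rintro x y u v ⟨h, rfl, rfl⟩ h1 h2
        exact (hR x y h).mul _ _))
    (fun g k h => map_L (H := B.structureGroupoid) _ (fun x y h h' => by
      obtain ⟨h1, h2, -⟩ := hR x y h
      exact (congrArg B.ι.toFun h2).symm.trans (lact_ι _ _ h1).symm) g k h _)

theorem mapStructureGroupoid_ι {B : BraidedQuiver M} (f : Hom A B) (x : A.carrier) :
    (mapStructureGroupoid f).toFun (A.ι.toFun x) = B.ι.toFun (f.toFun x) := rfl

end
end BraidedQuiver

theorem BraidedGroupoid.Hom.eq_of_toFun {M : Type u} {G H : BraidedGroupoid M} {f g : Hom G H}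
    (h : ∀ x, f.toFun x = g.toFun x) : f = g :=
  BraidedGroupoid.Hom.ext (funext h)

/-- The structure groupoid functor from non-degenerate braided quivers to braided groupoids. -/
noncomputable def functorF (M : Type u) : BraidedQuiver M ⥤ BraidedGroupoid M where
  obj A := A.structureGroupoid
  map f := BraidedQuiver.mapStructureGroupoid f
  map_id A := BraidedGroupoid.Hom.eq_of_toFun
    (BraidedQuiver.gpd_hom_ext (H := A.structureGroupoid.toGroupoidOver)
      (f := (BraidedQuiver.mapStructureGroupoid (𝟙 A)).toGroupoidHom)
      (g := (𝟙 A.structureGroupoid : A.structureGroupoid ⟶ A.structureGroupoid).toGroupoidHom)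
      (fun _ => rfl))
  map_comp {A B C} f g := BraidedGroupoid.Hom.eq_of_toFun
    (BraidedQuiver.gpd_hom_ext (H := C.structureGroupoid.toGroupoidOver)
      (f := (BraidedQuiver.mapStructureGroupoid (f ≫ g)).toGroupoidHom)
      (g := (show BraidedGroupoid.Hom A.structureGroupoid C.structureGroupoid from
        (show A.structureGroupoid ⟶ B.structureGroupoid from
          BraidedQuiver.mapStructureGroupoid f) ≫
        (show B.structureGroupoid ⟶ C.structureGroupoid from
          BraidedQuiver.mapStructureGroupoid g)).toGroupoidHom)
      (fun _ => rfl))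

end PostGpd

/-!
The adjunction is the composite of two.

* `F ⊣ U`. By the universal property `BraidedQuiver.lift` of the structure groupoid, a homomorphism
  of braided quivers from `A` to a braided groupoid `H` extends uniquely to a groupoid homomorphism
  `A.gpd → H`: the defining relations hold in `H` because `(x ⇀ y)(x ↼ y) = xy` there. The extension
  respects the left actions by `BraidedQuiver.map_L`, hence the braidings. Conversely, restricting a
  homomorphism of braided groupoids along `ι` respects `R`, since the braiding of the structure
  groupoid extends `R`. This is `structureGroupoidHomEquiv`.

* `P ⊣ B`. The products `γ ⋆ δ` and `γ · δ` determine each other through the common left action, as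
  `γ ⋆ δ = γ · (γ ▷ δ)` and `γ · δ = γ ⋆ (γ⁻¹ ⇀ δ)`. Hence a map is a homomorphism of post-groupoids
  `P G → H` if and only if it is a homomorphism of braided groupoids `G → B H`. This is
  `postGroupoidHomEquiv`.
-/

namespace PostGpd

/-! ### The structure groupoid is left adjoint to the forgetful functor -/

namespace BraidedQuiver
variable {M : Type u} {A : BraidedQuiver M} {H : BraidedGroupoid M}

/-- Restriction to the generators of a homomorphism out of the structure groupoid. -/
noncomputable def restrict (f : BraidedGroupoid.Hom A.structureGroupoid H) :
    Hom A H.toBraidedQuiver where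
  toFun x := f.toFun (A.ι.toFun x)
  src_toFun x := f.src_toFun (A.ι.toFun x)
  tgt_toFun x := f.tgt_toFun (A.ι.toFun x)
  comm := by
    rintro ⟨⟨x, y⟩, h⟩
    exact Subtype.ext (Prod.ext
      ((congrArg f.toFun (lact_ι x y h)).symm.trans (f.map_lact _ _ (tιι h)))
      ((congrArg f.toFun (ract_ι x y h)).symm.trans (f.map_ract _ _ (tιι h))))

/-- The extension to the structure groupoid of a homomorphism of braided quivers into a braided
groupoid. -/
noncomputable def extend (f : Hom A H.toBraidedQuiver) :
    BraidedGroupoid.Hom A.structureGroupoid H :=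
  have hl : ∀ x y (h : A.tgt x = A.src y) (h' : H.tgt (f.toFun x) = H.src (f.toFun y)),
      f.toFun (A.R.lact x y h) = H.σ.lact (f.toFun x) (f.toFun y) h' :=
    fun x y h _ => congrArg (fun p => p.1.1) (f.comm ⟨(x, y), h⟩)
  have hr : ∀ x y (h : A.tgt x = A.src y) (h' : H.tgt (f.toFun x) = H.src (f.toFun y)),
      f.toFun (A.R.ract x y h) = H.σ.ract (f.toFun x) (f.toFun y) h' :=
    fun x y h _ => congrArg (fun p => p.1.2) (f.comm ⟨(x, y), h⟩)
  BraidedGroupoid.Hom.ofLact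
    (lift (H := H.toGroupoidOver) f.toQuiverHom (by
      rintro x y u v ⟨h, rfl, rfl⟩ h1 h2
      exact (H.lact_mul_ract _ _ h1).symm.trans
        (H.mul_congr (hl x y h h1).symm (hr x y h h1).symm)))
    (fun g k h => map_L (H := H) _ (fun x y h h' => hl x y h h') g k h _)

variable (A H) in
/-- The universal property of the structure groupoid among braided groupoids. -/
noncomputable def structureGroupoidHomEquiv :
    BraidedGroupoid.Hom A.structureGroupoid H ≃ Hom A H.toBraidedQuiver where
  toFun := restrict
  invFun := extend
  left_inv f := BraidedGroupoid.Hom.eq_of_toFun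
    (gpd_hom_ext (f := (extend (restrict f)).toGroupoidHom) (g := f.toGroupoidHom) fun _ => rfl)
  right_inv _ := rfl

end BraidedQuiver

/-- The structure groupoid functor is left adjoint to the forgetful functor. -/
noncomputable def adjunctionFU (M : Type u) : functorF M ⊣ functorU M :=
  Adjunction.mkOfHomEquiv
    { homEquiv := BraidedQuiver.structureGroupoidHomEquiv
      homEquiv_naturality_left_symm := fun {A' _ H} _ _ =>
        -- Two homomorphisms out of a structure groupoid agree if they agree on generators.
        (BraidedQuiver.structureGroupoidHomEquiv A' H).injective rfl
      homEquiv_naturality_right := fun _ _ => rfl }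

/-! ### Post-groupoids and braided groupoids -/

namespace BraidedGroupoid
variable {M : Type u} {G : BraidedGroupoid M} {H : PostGroupoid M}

/-- A homomorphism of post-groupoids out of `P G`, as a homomorphism of braided groupoids. -/
noncomputable def ofPostGroupoidHom (f : PostGroupoid.Hom G.toPostGroupoid H) :
    Hom G H.toBraidedGroupoid :=
  Hom.ofLact
    { toFun := f.toFun
      src_toFun := f.proj_toFun
      tgt_toFun := f.Φ_toFun
      map_mul := fun x y h =>
        (congrArg f.toFun (G.dot_lact x y h)).symm.trans
          ((f.map_mul x (G.σ.lact x y h) (G.σ.src_lact x y h).symm).trans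
            (H.groupoid.mul_congr rfl (f.map_act x y h))) }
    f.map_act

/-- A homomorphism of braided groupoids into `B H`, as a homomorphism of post-groupoids. -/
def toPostGroupoidHom (f : Hom G H.toBraidedGroupoid) :
    PostGroupoid.Hom G.toPostGroupoid H where
  toFun := f.toFun
  proj_toFun := f.src_toFun
  Φ_toFun := f.tgt_toFun
  map_mul x y h := by
    have h1 : G.tgt (G.inv x) = G.src y := (G.tgt_inv x).trans h
    have h2 : G.tgt x = G.src (G.σ.lact (G.inv x) y h1) :=
      ((G.σ.src_lact _ _ h1).trans (G.src_inv x)).symm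
    have e := f.map_lact x (G.σ.lact (G.inv x) y h1) h2
    rw [G.lact_inv_lact x y h1 h2] at e
    exact (f.map_mul x (G.σ.lact (G.inv x) y h1) h2).trans (H.groupoid.mul_congr rfl e.symm)
  map_act := f.map_lact

variable (G H) in
/-- The homomorphisms `P G → H` and `G → B H` are the same maps. -/
noncomputable def postGroupoidHomEquiv :
    PostGroupoid.Hom G.toPostGroupoid H ≃ Hom G H.toBraidedGroupoid where
  toFun := ofPostGroupoidHom
  invFun := toPostGroupoidHom
  left_inv _ := rfl
  right_inv _ := rfl

end BraidedGroupoid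

/-- The functor from braided groupoids to post-groupoids is left adjoint to the
Grossman-Larson functor. -/
noncomputable def adjunctionPB (M : Type u) : functorP M ⊣ functorB M :=
  Adjunction.mkOfHomEquiv
    { homEquiv := BraidedGroupoid.postGroupoidHomEquiv
      homEquiv_naturality_left_symm := fun _ _ => rfl
      homEquiv_naturality_right := fun _ _ => rfl }

end PostGpd

/-- For every set `M`, the composite `P ∘ F` (structure groupoid with its braiding, viewed as a
post-groupoid) is left adjoint to `U ∘ B` (the braided quiver of a post-groupoid). -/
theorem mainTheorem10 (M : Type u) :
    Nonempty ((PostGpd.functorF M ⋙ PostGpd.functorP M) ⊣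
      (PostGpd.functorB M ⋙ PostGpd.functorU M)) :=
  ⟨(PostGpd.adjunctionFU M).comp (PostGpd.adjunctionPB M)⟩
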